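/- Let $n,d\ge 0$ be integers, $V_1\in C^\infty(\mathbb R^n;\mathbb R)$, $V_2\in C^\infty(\mathbb R^d;\mathbb R)$, $\varphi_0^x\in\mathcal S(\mathbb R^n;\mathbb C)$, $\varphi_0^y\in\mathcal S(\mathbb R^d;\mathbb C)$, $\langle z\rangle=(1+|z|^2)^{1/2}$. Let $W\in C^\infty(\mathbb R^{n+d};\mathbb R)$ be a coupling potential with $|W(x,y)|\le C\langle x\rangle^2\langle y\rangle^2$ for some constant $C$ (for instance, at most quadratic, or $W=\frac12\vec\eta\cdot x\,|y|^2$). Put $H_x=-\frac12\Delta_x+V_1$, $H_y=-\frac12\Delta_y+V_2$, $H=H_x+H_y+W$. Let $\psi$ be a solution on $[0,\infty)$ of $i\partial_t\psi=H\psi$, $\psi(0,x,y)=\varphi_0^x(x)\varphi_0^y(y)$, and let $(\phi^x,\phi^y)$ be a solution on $[0,\infty)$ of the time-dependent Hartree system $$i\partial_t\phi^x=H_x\phi^x+\langle W\rangle_y(t)\phi^x,\quad \phi^x(0)=\varphi_0^x,\qquad i\partial_t\phi^y=H_y\phi^y+\langle W\rangle_x(t)\phi^y,\quad \phi^y(0)=\varphi_0^y,$$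 where $\langle g\rangle_x(t)=\int g\,|\phi^x(t,x)|^2dx\big/\int|\phi^x(t,x)|^2dx$, $\langle g\rangle_y(t)=\int g\,|\phi^y(t,y)|^2dy\big/\int|\phi^y(t,y)|^2dy$ (read as $0$ when the denominator vanishes), with $|x|\phi^x\in C([0,\infty);L^2(\mathbb R^n))$ and $|y|\phi^y\in C([0,\infty);L^2(\mathbb R^d))$. Solutions are strong: they are $C^1$ in time with values in $L^2$ and, at each time, lie in the domain of the $L^2$-closure of the Schrödinger operator on $C_c^\infty$ and satisfy the equation with this closure. Let $$\phi_{\rm app}(t,x,y)=\phi^x(t,x)\,\phi^y(t,y)\,e^{i\int_0^t\langle W\rangle(s)ds},\qquad \langle W\rangle(t)=\frac{\int W|\phi^x(t,x)\phi^y(t,y)|^2dxdy}{\int|\phi^x(t,x)\phi^y(t,y)|^2dxdy}.$$ Then, for all $t\ge0$ (right-hand sides may be $+\infty$): 1. If $W(x,y)=W_1(x)W_2(y)$ with $W_1,W_2$ smooth, and $W_1\phi^x(s)\in L^2(\mathbb R^n)$, $W_2\phi^y(s)\in L^2(\mathbb R^d)$ for all $s\ge0$ (so that the variances are defined), then $$\|\psi(t)-\phi_{\rm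 app}(t)\|_{L^2}\le\|\varphi_0^x\|_{L^2}\|\varphi_0^y\|_{L^2}\int_0^t\sqrt{\big(\langle W_1^2\rangle_x(s)-\langle W_1\rangle_x^2(s)\big)\big(\langle W_2^2\rangle_y(s)-\langle W_2\rangle_y^2(s)\big)}\,ds.$$ 2. If $W(x,y)=W_1(x)\,\eta|y|^2$ with $W_1$ smooth and bounded and $\eta\ge0$, then $$\|\psi(t)-\phi_{\rm app}(t)\|_{L^2}\le16\,\eta\,\|W_1\|_{L^\infty}\|\varphi_0^x\|_{L^2}\int_0^t\big\||y|^2\phi^y(s)\big\|_{L^2}\,ds.$$ 3. If $\sigma_x,\sigma_y\ge0$ and $\eta:=\|\langle x\rangle^{-\sigma_x}\langle y\rangle^{-\sigma_y}\nabla_yW\|_{L^\infty}<\infty$ (with $W$ not necessarily a product), then $$\|\psi(t)-\phi_{\rm app}(t)\|_{L^2}\le8\,\eta\int_0^t\|\langle x\rangle^{\sigma_x}\phi^x(s)\|_{L^2}\,\|\langle y\rangle^{\sigma_y}|y|\phi^y(s)\|_{L^2}\,ds.$$ -/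

import Mathlib

open MeasureTheory Filter Set Topology
open scoped ContDiff SchwartzMap ENNReal

noncomputable section

namespace Hartree

/-- The Euclidean space `ℝᵐ`. -/
abbrev Euc (m : ℕ) : Type := EuclideanSpace ℝ (Fin m)

/-- The Hilbert space of complex valued square integrable functions on `X` (Lebesgue measure). -/
abbrev L2 (X : Type*) [MeasureSpace X] : Type _ := Lp ℂ 2 (volume : Measure X)

/-- The Japanese bracket `⟨x⟩ = (1 + |x|²)^{1/2}`. -/
def bracket {m : ℕ} (x : Euc m) : ℝ := Real.sqrt (1 + ‖x‖ ^ 2)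

/-! ### Schrödinger operators -/

/-- `-½ Δ f + U f` on `ℝᵐ`, for smooth `f`. -/
def schrodingerOp {m : ℕ} (U : Euc m → ℝ) (f : Euc m → ℂ) (x : Euc m) : ℂ :=
  -(1 / 2 : ℂ) * Laplacian.laplacian f x + (U x : ℂ) * f x

/-- `H f = (H_x + H_y + W) f` on `ℝⁿ × ℝᵈ`, for smooth `f`, where `H_x = -½ Δ_x + V₁(x)` and
`H_y = -½ Δ_y + V₂(y)`. -/
def fullHamiltonian {n d : ℕ} (V₁ : Euc n → ℝ) (V₂ : Euc d → ℝ) (W : Euc n → Euc d → ℝ)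
    (f : Euc n × Euc d → ℂ) (z : Euc n × Euc d) : ℂ :=
  schrodingerOp V₁ (fun x => f (x, z.2)) z.1 + schrodingerOp V₂ (fun y => f (z.1, y)) z.2
    + (W z.1 z.2 : ℂ) * f z

/-- `u` is in the domain of the `L²`-closure of the operator `T`, originally defined on smooth
compactly supported functions, and the closure maps `u` to `v`. -/
def InClosure {X : Type*} [NormedAddCommGroup X] [NormedSpace ℝ X] [MeasureSpace X]
    (T : (X → ℂ) → X → ℂ) (u v : L2 X) : Prop :=
  ∃ f : ℕ → X → ℂ, (∀ k, ContDiff ℝ ∞ (f k) ∧ HasCompactSupport (f k)) ∧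
    Tendsto (fun k => eLpNorm (fun z => f k z - u z) 2 volume) atTop (𝓝 0) ∧
    Tendsto (fun k => eLpNorm (fun z => T (f k) z - v z) 2 volume) atTop (𝓝 0)

/-- `u` is a (strong) solution on `[0, ∞)` of `i ∂ₜ u = T(t) u`, `u(0) = u₀`: it is continuously
differentiable with values in `L²`, and at each time it lies in the domain of (the closure of)
`T(t)` and satisfies the equation. -/
structure Solves {X : Type*} [NormedAddCommGroup X] [NormedSpace ℝ X] [MeasureSpace X]
    (T : ℝ → (X → ℂ) → X → ℂ) (u₀ : X → ℂ) (u : ℝ → L2 X) : Prop where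
  init : ∀ᵐ z, u 0 z = u₀ z
  evol : ∃ u' : ℝ → L2 X, ContinuousOn u' (Ici 0) ∧
    ∀ t, 0 ≤ t → HasDerivWithinAt u (u' t) (Ici 0) t ∧ InClosure (T t) (u t) (Complex.I • u' t)

/-! ### Averages and the time-dependent Hartree system -/

/-- The average `∫ g |φ|² / ∫ |φ|²`. -/
def avg {X : Type*} [MeasureSpace X] (g : X → ℝ) (φ : X → ℂ) : ℝ :=
  (∫ z, g z * ‖φ z‖ ^ 2) / ∫ z, ‖φ z‖ ^ 2

/-- `t ↦ |x| u(t)` is continuous on `[0, ∞)` with values in `L²`. -/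
def ContinuousMoment {m : ℕ} (u : ℝ → L2 (Euc m)) : Prop :=
  ∃ g : ℝ → L2 (Euc m), ContinuousOn g (Ici 0) ∧
    ∀ t, 0 ≤ t → ∀ᵐ x, g t x = (‖x‖ : ℂ) * u t x

/-- `(φx, φy)` solves on `[0, ∞)` the Hartree system
`i ∂ₜ φx = H_x φx + ⟨W⟩_y φx`, `i ∂ₜ φy = H_y φy + ⟨W⟩_x φy`
with initial data `φ₀x`, `φ₀y`, with first moments continuous in time. -/
structure IsHartreeSolution {n d : ℕ} (V₁ : Euc n → ℝ) (V₂ : Euc d → ℝ) (W : Euc n → Euc d → ℝ)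
    (φ₀x : Euc n → ℂ) (φ₀y : Euc d → ℂ) (φx : ℝ → L2 (Euc n)) (φy : ℝ → L2 (Euc d)) :
    Prop where
  moment_x : ContinuousMoment φx
  moment_y : ContinuousMoment φy
  solves_x : Solves
    (fun t => schrodingerOp fun x => V₁ x + avg (fun y => W x y) (φy t)) φ₀x φx
  solves_y : Solves
    (fun t => schrodingerOp fun y => V₂ y + avg (fun x => W x y) (φx t)) φ₀y φy

/-- The full average `⟨W⟩(t)`. -/
def fullAvg {n d : ℕ} (W : Euc n → Euc d → ℝ) (φx : ℝ → L2 (Euc n)) (φy : ℝ → L2 (Euc d))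
    (t : ℝ) : ℝ :=
  avg (fun z : Euc n × Euc d => W z.1 z.2) (fun z => φx t z.1 * φy t z.2)

/-- The mean-field approximation `φ_app(t,x,y) = φx(t,x) φy(t,y) exp(i ∫₀ᵗ ⟨W⟩(s) ds)`. -/
def meanField {n d : ℕ} (W : Euc n → Euc d → ℝ) (φx : ℝ → L2 (Euc n)) (φy : ℝ → L2 (Euc d))
    (t : ℝ) (z : Euc n × Euc d) : ℂ :=
  φx t z.1 * φy t z.2 * Complex.exp (Complex.I * ((∫ s in (0 : ℝ)..t, fullAvg W φx φy s : ℝ) : ℂ))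

/-- The `L²(ℝⁿ⁺ᵈ)`-norm of the error `ψ(t) - φ_app(t)`. -/
def meanFieldError {n d : ℕ} (W : Euc n → Euc d → ℝ) (ψ : ℝ → L2 (Euc n × Euc d))
    (φx : ℝ → L2 (Euc n)) (φy : ℝ → L2 (Euc d)) (t : ℝ) : ℝ≥0∞ :=
  eLpNorm (fun z => ψ t z - meanField W φx φy t z) 2 volume

/-- The setting of the estimates: `W` is smooth with `|W(x,y)| ≤ C ⟨x⟩² ⟨y⟩²`, `ψ` solves the
Schrödinger equation for `H` with initial datum `φ₀x(x) φ₀y(y)`, and `(φx, φy)` solves the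
Hartree system with initial data `φ₀x`, `φ₀y`. -/
structure Setting {n d : ℕ} (V₁ : Euc n → ℝ) (V₂ : Euc d → ℝ) (W : Euc n → Euc d → ℝ)
    (φ₀x : Euc n → ℂ) (φ₀y : Euc d → ℂ) (ψ : ℝ → L2 (Euc n × Euc d))
    (φx : ℝ → L2 (Euc n)) (φy : ℝ → L2 (Euc d)) : Prop where
  smooth : ContDiff ℝ ∞ (fun z : Euc n × Euc d => W z.1 z.2)
  growth : ∃ C : ℝ, ∀ x y, |W x y| ≤ C * bracket x ^ 2 * bracket y ^ 2
  exact : Solves (fun _ => fullHamiltonian V₁ V₂ W) (fun z => φ₀x z.1 * φ₀y z.2) ψ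
  hartree : IsHartreeSolution V₁ V₂ W φ₀x φ₀y φx φy

end Hartree

end

noncomputable section

namespace Hartree

open scoped ComplexConjugate

/-! ### Square integrable functions and elementary tensors -/

section Tensor

variable {X Y : Type*} [MeasureSpace X] [MeasureSpace Y]

/-! Write `a` for the mean-field approximation and `S = (W - ⟨W⟩_y - ⟨W⟩_x + ⟨W⟩) a`. Adding the two
Hartree equations and differentiating the phase gives, formally, `H a = i a' + S`. The error `r = ψ
- a` vanishes at time 0, and symmetry of `H` gives `Re⟨r, r'⟩ = Im⟨r, S⟩ ≤ ‖r‖ ‖S‖`. Hence `‖r(t)‖ ≤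
∫₀ᵗ ‖S‖`, which is `Setting.meanFieldError_le`.

No self-adjointness is needed, and `a` need not lie in the domain of the closure of `H`. The
identity `H a = i a' + S` is proved only against test functions, slice by slice with Fubini
(`inner_fullHamiltonian_tensor`). It extends to pairings with `ψ`, which does lie in that domain
(`InClosure.inner_eq`). The remaining terms vanish because `ψ` and `a` have constant norm and `S` is
a real multiple of `a` (`re_inner_sub_le`).

It remains to bound `S`. For a product coupling it factors as `(W₁ - ⟨W₁⟩)φx ⊗ (W₂ - ⟨W₂⟩)φy`, whose
norm is a product of standard deviations times the conserved masses. In general, subtracting an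
average is an orthogonal projection in a weighted `L²` space, so any other choice of constant only
increases the norm (`eLpNorm_sub_avg_mul_le`). Constant 0 in both variables gives the second
estimate. Constant 0 in `x` and `W(x, 0)` in `y`, followed by the mean value inequality, gives the
third. Both hold with constant 1 in place of 16 and 8. -/

lemma inner_toLp {f g : X → ℂ} (hf : MemLp f 2 volume) (hg : MemLp g 2 volume) :
    inner ℂ (hf.toLp f) (hg.toLp g) = ∫ x, conj (f x) * g x := by
  rw [L2.inner_def]
  refine integral_congr_ae ?_
  filter_upwards [hf.coeFn_toLp, hg.coeFn_toLp] with x h₁ h₂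
  rw [h₁, h₂, RCLike.inner_apply']

lemma inner_L2 (u v : L2 X) : inner ℂ u v = ∫ x, conj (u x) * v x := by
  rw [L2.inner_def]
  simp only [RCLike.inner_apply']

lemma sq_eLpNorm_two {E : Type*} [NormedAddCommGroup E] (f : X → E) :
    eLpNorm f 2 volume ^ 2 = ∫⁻ x, ‖f x‖ₑ ^ 2 := by
  have h := eLpNorm_nnreal_pow_eq_lintegral (μ := (volume : Measure X)) (f := f) (p := 2) two_ne_zero
  simpa using h

lemma eLpNorm_two_le_of_sq {f : X → ℂ} {c : ℝ≥0∞} (h : ∫⁻ x, ‖f x‖ₑ ^ 2 ≤ c ^ 2) :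
    eLpNorm f 2 volume ≤ c := by
  rw [← sq_eLpNorm_two] at h
  exact (ENNReal.pow_le_pow_left_iff two_ne_zero).1 h

lemma aestronglyMeasurable_tensor {f : X → ℂ} {g : Y → ℂ} (hf : AEStronglyMeasurable f volume)
    (hg : AEStronglyMeasurable g volume) :
    AEStronglyMeasurable (fun z : X × Y => f z.1 * g z.2) volume :=
  hf.comp_fst.mul hg.comp_snd

lemma ae_fst {p : X → Prop} (h : ∀ᵐ x, p x) : ∀ᵐ z : X × Y, p z.1 :=
  Measure.quasiMeasurePreserving_fst.ae h

lemma ae_snd {p : Y → Prop} (h : ∀ᵐ y, p y) : ∀ᵐ z : X × Y, p z.2 :=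
  Measure.quasiMeasurePreserving_snd.ae h

variable [SFinite (volume : Measure Y)]

lemma eLpNorm_tensor {f : X → ℂ} {g : Y → ℂ} (hf : AEStronglyMeasurable f volume)
    (hg : AEStronglyMeasurable g volume) :
    eLpNorm (fun z : X × Y => f z.1 * g z.2) 2 volume
      = eLpNorm f 2 volume * eLpNorm g 2 volume := by
  have h : eLpNorm (fun z : X × Y => f z.1 * g z.2) 2 volume ^ 2
      = (eLpNorm f 2 volume * eLpNorm g 2 volume) ^ 2 := by
    rw [mul_pow, sq_eLpNorm_two, sq_eLpNorm_two, sq_eLpNorm_two, Measure.volume_eq_prod,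
      ← lintegral_prod_mul (hf.enorm.pow_const 2) (hg.enorm.pow_const 2)]
    simp only [enorm_mul, mul_pow]
  exact (ENNReal.pow_right_strictMono two_ne_zero).injective h

lemma memLp_tensor {f : X → ℂ} {g : Y → ℂ} (hf : MemLp f 2 volume) (hg : MemLp g 2 volume) :
    MemLp (fun z : X × Y => f z.1 * g z.2) 2 volume :=
  ⟨aestronglyMeasurable_tensor hf.1 hg.1, by
    rw [eLpNorm_tensor hf.1 hg.1]; exact ENNReal.mul_lt_top hf.2 hg.2⟩

/-- The elementary tensor `(x, y) ↦ u x * v y`. -/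
def tensor (u : L2 X) (v : L2 Y) : L2 (X × Y) :=
  (memLp_tensor (Lp.memLp u) (Lp.memLp v)).toLp _

lemma coeFn_tensor (u : L2 X) (v : L2 Y) :
    tensor u v =ᵐ[volume] fun z : X × Y => u z.1 * v z.2 :=
  MemLp.coeFn_toLp _

lemma norm_tensor (u : L2 X) (v : L2 Y) : ‖tensor u v‖ = ‖u‖ * ‖v‖ := by
  rw [tensor, Lp.norm_toLp, eLpNorm_tensor (Lp.memLp u).1 (Lp.memLp v).1, ENNReal.toReal_mul,
    Lp.norm_def, Lp.norm_def]

lemma tensor_add_left (u u' : L2 X) (v : L2 Y) : tensor (u + u') v = tensor u v + tensor u' v := by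
  refine Lp.ext ?_
  filter_upwards [coeFn_tensor (u + u') v, coeFn_tensor u v, coeFn_tensor u' v,
    Lp.coeFn_add (tensor u v) (tensor u' v), ae_fst (Y := Y) (Lp.coeFn_add u u')] with z h h₁ h₂ h₃ h₄
  rw [h, h₃, Pi.add_apply, h₁, h₂, h₄, Pi.add_apply, add_mul]

lemma tensor_add_right (u : L2 X) (v v' : L2 Y) : tensor u (v + v') = tensor u v + tensor u v' := by
  refine Lp.ext ?_
  filter_upwards [coeFn_tensor u (v + v'), coeFn_tensor u v, coeFn_tensor u v',
    Lp.coeFn_add (tensor u v) (tensor u v'), ae_snd (X := X) (Lp.coeFn_add v v')] with z h h₁ h₂ h₃ h₄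
  rw [h, h₃, Pi.add_apply, h₁, h₂, h₄, Pi.add_apply, mul_add]

lemma tensor_smul_left (c : ℂ) (u : L2 X) (v : L2 Y) : tensor (c • u) v = c • tensor u v := by
  refine Lp.ext ?_
  filter_upwards [coeFn_tensor (c • u) v, coeFn_tensor u v,
    Lp.coeFn_smul c (tensor u v), ae_fst (Y := Y) (Lp.coeFn_smul c u)] with z h h₁ h₂ h₃
  rw [h, h₂, Pi.smul_apply, h₁, h₃, Pi.smul_apply, smul_eq_mul, smul_eq_mul, mul_assoc]

lemma tensor_smul_right (c : ℂ) (u : L2 X) (v : L2 Y) : tensor u (c • v) = c • tensor u v := by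
  refine Lp.ext ?_
  filter_upwards [coeFn_tensor u (c • v), coeFn_tensor u v,
    Lp.coeFn_smul c (tensor u v), ae_snd (X := X) (Lp.coeFn_smul c v)] with z h h₁ h₂ h₃
  rw [h, h₂, Pi.smul_apply, h₁, h₃, Pi.smul_apply, smul_eq_mul, smul_eq_mul, mul_left_comm]

/-- The elementary tensor as a continuous bilinear map. -/
def tensorL : L2 X →L[ℝ] L2 Y →L[ℝ] L2 (X × Y) :=
  LinearMap.mkContinuous₂
    (LinearMap.mk₂ ℝ tensor tensor_add_left
      (fun c u v => by
        rw [← algebraMap_smul ℂ c u, tensor_smul_left, algebraMap_smul])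
      tensor_add_right
      (fun c u v => by
        rw [← algebraMap_smul ℂ c v, tensor_smul_right, algebraMap_smul])) 1
    (fun u v => by
      rw [one_mul]
      exact (norm_tensor u v).le)

lemma continuousOn_tensor {u : ℝ → L2 X} {v : ℝ → L2 Y} {s : Set ℝ} (hu : ContinuousOn u s)
    (hv : ContinuousOn v s) : ContinuousOn (fun t => tensor (u t) (v t)) s :=
  (tensorL.continuous.comp_continuousOn hu).clm_apply hv

variable [SFinite (volume : Measure X)]

lemma inner_tensor (u u' : L2 X) (v v' : L2 Y) :
    inner ℂ (tensor u v) (tensor u' v') = inner ℂ u u' * inner ℂ v v' := by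
  rw [inner_L2, inner_L2, inner_L2, ← integral_prod_mul]
  refine integral_congr_ae ?_
  filter_upwards [coeFn_tensor u v, coeFn_tensor u' v'] with z h₁ h₂
  rw [h₁, h₂, map_mul]
  ring

end Tensor

/-! ### Quadratic forms of bounded multiplication operators -/

section Multiplication

variable {X : Type*} [MeasureSpace X]

/-- Multiplication by a bounded function is a bounded operator `M` on `L²` (Hölder with exponents
`∞, 2, 2`), and the integral is `Re⟨u, M u⟩`. -/
lemma continuous_integral_mul_sq {w : X → ℝ} (hw : AEStronglyMeasurable w volume) {C : ℝ}
    (hC : ∀ x, |w x| ≤ C) : Continuous fun u : L2 X => ∫ x, w x * ‖u x‖ ^ 2 := by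
  have hw' : MemLp (fun x => (w x : ℂ)) ∞ volume :=
    memLp_top_of_bound (Complex.continuous_ofReal.comp_aestronglyMeasurable hw) C
      (ae_of_all _ fun x => by simpa using hC x)
  let M := ((ContinuousLinearMap.mul ℂ ℂ).holderL (volume : Measure X) ∞ 2 2) (hw'.toLp _)
  have hM (u : L2 X) : ∫ x, w x * ‖u x‖ ^ 2 = (inner ℂ u (M u)).re := by
    have h : inner ℂ u (M u) = ∫ x, ((w x * ‖u x‖ ^ 2 : ℝ) : ℂ) := by
      rw [inner_L2]
      refine integral_congr_ae ?_
      filter_upwards [hw'.coeFn_toLp,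
        (ContinuousLinearMap.mul ℂ ℂ).coeFn_holder (r := 2) (hw'.toLp _) u] with x h₁ h₂
      have h₃ : M u x = w x * u x := by
        rw [← h₁]
        exact h₂
      rw [h₃, mul_left_comm, Complex.conj_mul']
      push_cast
      ring
    rw [h, integral_complex_ofReal, Complex.ofReal_re]
  simp only [hM]
  exact Complex.continuous_re.comp (continuous_id.inner M.continuous)

end Multiplication

/-! ### The closure of an operator -/

section Closure

variable {X : Type*} [NormedAddCommGroup X] [NormedSpace ℝ X] [MeasureSpace X]
  [OpensMeasurableSpace X] [IsFiniteMeasureOnCompacts (volume : Measure X)]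

/-- An identity tested on smooth compactly supported functions passes to the limit along the
sequence defining the closure. Nothing is asked of `p` beyond `L²`: it plays the role of an element
of the domain of the adjoint. -/
lemma InClosure.inner_eq {T : (X → ℂ) → X → ℂ}
    (hT : ∀ f, ContDiff ℝ ∞ f → HasCompactSupport f → MemLp (T f) 2 volume) {u v p q : L2 X}
    (h : InClosure T u v)
    (hpq : ∀ f, ContDiff ℝ ∞ f → HasCompactSupport f →
      ∫ x, conj (T f x) * p x = ∫ x, conj (f x) * q x) :
    inner ℂ v p = inner ℂ u q := by
  obtain ⟨f, hf, hu, hv⟩ := h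
  have hfL k : MemLp (f k) 2 volume := (hf k).1.continuous.memLp_of_hasCompactSupport (hf k).2
  have hTL k : MemLp (T (f k)) 2 volume := hT _ (hf k).1 (hf k).2
  have hu' := (Lp.tendsto_Lp_iff_tendsto_eLpNorm'' f hfL u (Lp.memLp u)).2 hu
  have hv' := (Lp.tendsto_Lp_iff_tendsto_eLpNorm'' (fun k => T (f k)) hTL v (Lp.memLp v)).2 hv
  rw [Lp.toLp_coeFn] at hu' hv'
  refine tendsto_nhds_unique (hv'.inner (tendsto_const_nhds (x := p))) ?_
  convert hu'.inner (tendsto_const_nhds (x := q)) using 2 with k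
  have hp : p = (Lp.memLp p).toLp p := (Lp.toLp_coeFn p (Lp.memLp p)).symm
  have hq : q = (Lp.memLp q).toLp q := (Lp.toLp_coeFn q (Lp.memLp q)).symm
  rw [hp, hq, inner_toLp, inner_toLp]
  exact hpq _ (hf k).1 (hf k).2

/-- An operator is symmetric on smooth compactly supported functions. -/
structure SymmetricOnTest (T : (X → ℂ) → X → ℂ) : Prop where
  memLp : ∀ f, ContDiff ℝ ∞ f → HasCompactSupport f → MemLp (T f) 2 volume
  symm : ∀ f g, ContDiff ℝ ∞ f → HasCompactSupport f → ContDiff ℝ ∞ g → HasCompactSupport g →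
    ∫ x, conj (T f x) * g x = ∫ x, conj (f x) * T g x

lemma SymmetricOnTest.integral_eq {T : (X → ℂ) → X → ℂ} (hT : SymmetricOnTest T) {u v : L2 X}
    (h : InClosure T u v) {f : X → ℂ} (hf : ContDiff ℝ ∞ f) (hf' : HasCompactSupport f) :
    ∫ x, conj (T f x) * u x = ∫ x, conj (f x) * v x := by
  have hfL : MemLp f 2 volume := hf.continuous.memLp_of_hasCompactSupport hf'
  have hTf := hT.memLp f hf hf'
  -- Symmetry on test functions is the tested identity with `p = f` and `q = T f`; conjugating the
  -- result puts `u` and `v` on the right.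
  have key : inner ℂ v (hfL.toLp f) = inner ℂ u (hTf.toLp (T f)) := by
    refine h.inner_eq hT.memLp fun g hg hg' => ?_
    have h₁ : ∫ x, conj (T g x) * hfL.toLp f x = ∫ x, conj (T g x) * f x :=
      integral_congr_ae (by filter_upwards [hfL.coeFn_toLp] with x hx; rw [hx])
    have h₂ : ∫ x, conj (g x) * hTf.toLp (T f) x = ∫ x, conj (g x) * T f x :=
      integral_congr_ae (by filter_upwards [hTf.coeFn_toLp] with x hx; rw [hx])
    rw [h₁, h₂, hT.symm g f hg hg' hf hf']
  rw [← inner_conj_symm, ← inner_conj_symm u] at key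
  have key' := (starRingEnd ℂ).injective key
  have hu : u = (Lp.memLp u).toLp u := (Lp.toLp_coeFn u (Lp.memLp u)).symm
  have hv : v = (Lp.memLp v).toLp v := (Lp.toLp_coeFn v (Lp.memLp v)).symm
  rw [hu, hv, inner_toLp, inner_toLp] at key'
  exact key'.symm

lemma SymmetricOnTest.inner_comm {T : (X → ℂ) → X → ℂ} (hT : SymmetricOnTest T) {u v : L2 X}
    (h : InClosure T u v) : inner ℂ v u = inner ℂ u v :=
  h.inner_eq hT.memLp fun _ hf hf' => hT.integral_eq h hf hf'

lemma SymmetricOnTest.re_inner_eq_zero {T : (X → ℂ) → X → ℂ} (hT : SymmetricOnTest T) {u u' : L2 X}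
    (h : InClosure T u (Complex.I • u')) : (inner ℂ u u').re = 0 := by
  have h₁ := hT.inner_comm h
  rw [inner_smul_left, inner_smul_right, Complex.conj_I] at h₁
  have h₂ := congrArg Complex.im h₁
  have h₃ : (inner ℂ u' u).re = (inner ℂ u u').re := by
    rw [← inner_conj_symm, Complex.conj_re]
  simp [h₃] at h₂
  linarith

end Closure

lemma norm_eq_of_hasDerivWithinAt {E : Type*} [NormedAddCommGroup E] [InnerProductSpace ℂ E]
    {u u' : ℝ → E} (hu : ∀ t, 0 ≤ t → HasDerivWithinAt u (u' t) (Ici 0) t)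
    (h : ∀ t, 0 ≤ t → (inner ℂ (u t) (u' t)).re = 0) {t : ℝ} (ht : 0 ≤ t) : ‖u t‖ = ‖u 0‖ := by
  let _ : InnerProductSpace ℝ E := InnerProductSpace.rclikeToReal ℂ E
  have hd (s : ℝ) (hs : 0 ≤ s) : HasDerivWithinAt (fun s => ‖u s‖ ^ 2) 0 (Ici 0) s := by
    have := (hu s hs).norm_sq
    rwa [real_inner_eq_re_inner ℂ, RCLike.re_eq_complex_re, h s hs, mul_zero] at this
  have hc : ‖u t‖ ^ 2 = ‖u 0‖ ^ 2 := by
    refine constant_of_has_deriv_right_zero (a := 0) (b := t)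
      (fun s hs => ((hd s hs.1).mono Icc_subset_Ici_self).continuousWithinAt)
      (fun s hs => (hd s hs.1).mono (Ici_subset_Ici.2 hs.1)) t (right_mem_Icc.2 ht)
  exact (pow_left_inj₀ (norm_nonneg _) (norm_nonneg _) two_ne_zero).1 hc

/-! ### Symmetry of Schrödinger operators on test functions -/

section PartialLaplacian

variable {m : ℕ} {Z : Type*} [NormedAddCommGroup Z] [NormedSpace ℝ Z]

/-- The Laplacian in the directions of the range of `ι`. -/
def partialLaplacian (ι : Euc m →L[ℝ] Z) (f : Z → ℂ) (z : Z) : ℂ :=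
  ∑ i, iteratedFDeriv ℝ 2 f z fun _ => ι (EuclideanSpace.basisFun (Fin m) ℝ i)

/-- Expressing the Laplacian of a slice through the second derivative of `f` on the whole space
makes its joint continuity and compact support visible. -/
lemma laplacian_comp_affine (ι : Euc m →L[ℝ] Z) {f : Z → ℂ} (hf : ContDiff ℝ ∞ f) (a : Z)
    (x : Euc m) :
    Laplacian.laplacian (fun x => f (a + ι x)) x = partialLaplacian ι f (a + ι x) := by
  rw [InnerProductSpace.laplacian_eq_iteratedFDeriv_orthonormalBasis _
    (EuclideanSpace.basisFun (Fin m) ℝ), partialLaplacian]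
  refine Finset.sum_congr rfl fun i _ => ?_
  have hg : ContDiff ℝ ∞ fun z => f (a + z) := hf.comp (contDiff_const.add contDiff_id)
  have h := ι.iteratedFDeriv_comp_right (f := fun z => f (a + z)) hg x (i := 2)
    (WithTop.coe_le_coe.2 (le_top : (2 : ℕ∞) ≤ ⊤))
  change iteratedFDeriv ℝ 2 ((fun z => f (a + z)) ∘ ι) x _ = _
  rw [h, iteratedFDeriv_comp_add_left, ContinuousMultilinearMap.compContinuousLinearMap_apply]
  congr 1
  ext j
  fin_cases j <;> rfl

lemma continuous_partialLaplacian (ι : Euc m →L[ℝ] Z) {f : Z → ℂ} (hf : ContDiff ℝ ∞ f) :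
    Continuous (partialLaplacian ι f) := by
  have := hf.continuous_iteratedFDeriv (m := 2) (WithTop.coe_le_coe.2 (le_top : (2 : ℕ∞) ≤ ⊤))
  unfold partialLaplacian
  fun_prop

lemma hasCompactSupport_partialLaplacian (ι : Euc m →L[ℝ] Z) {f : Z → ℂ}
    (hf : HasCompactSupport f) : HasCompactSupport (partialLaplacian ι f) :=
  (hf.iteratedFDeriv (𝕜 := ℝ) 2).comp_left (g := fun M : Z [×2]→L[ℝ] ℂ =>
    ∑ i, M fun _ => ι (EuclideanSpace.basisFun (Fin m) ℝ i)) (by simp)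

end PartialLaplacian

lemma integrable_conj_mul {X : Type*} [MeasureSpace X] {f g : X → ℂ} (hf : MemLp f 2 volume)
    (hg : MemLp g 2 volume) : Integrable fun x => conj (f x) * g x :=
  hf.star.integrable_mul hg

lemma integral_add_add {X E : Type*} [MeasureSpace X] [NormedAddCommGroup E] [NormedSpace ℝ E]
    {f g h : X → E} (hf : Integrable f) (hg : Integrable g) (hh : Integrable h) :
    ∫ x, (f x + g x + h x) = (∫ x, f x) + (∫ x, g x) + ∫ x, h x := by
  rw [← integral_add hf hg]
  exact integral_add (hf.add hg) hh

/-! ### Schrödinger operators in one variable -/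

section OneVariable

variable {m : ℕ} {U : Euc m → ℝ}

lemma schrodingerOp_eq (U : Euc m → ℝ) {f : Euc m → ℂ} (hf : ContDiff ℝ ∞ f) :
    schrodingerOp U f = fun x =>
      -(1 / 2 : ℂ) * partialLaplacian (ContinuousLinearMap.id ℝ (Euc m)) f x + (U x : ℂ) * f x := by
  ext x
  have := laplacian_comp_affine (ContinuousLinearMap.id ℝ (Euc m)) hf 0 x
  simp only [zero_add, ContinuousLinearMap.id_apply] at this
  rw [schrodingerOp, this]

lemma continuous_schrodingerOp (hU : Continuous U) {f : Euc m → ℂ} (hf : ContDiff ℝ ∞ f) :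
    Continuous (schrodingerOp U f) := by
  rw [schrodingerOp_eq U hf]
  have := continuous_partialLaplacian (ContinuousLinearMap.id ℝ (Euc m)) hf
  have := hf.continuous
  fun_prop

lemma memLp_schrodingerOp (hU : Continuous U) {f : Euc m → ℂ} (hf : ContDiff ℝ ∞ f)
    (hf' : HasCompactSupport f) : MemLp (schrodingerOp U f) 2 volume := by
  refine (continuous_schrodingerOp hU hf).memLp_of_hasCompactSupport ?_
  rw [schrodingerOp_eq U hf]
  exact (hasCompactSupport_partialLaplacian _ hf').mul_left.add hf'.mul_left

lemma integral_conj_laplacian_mul {f g : Euc m → ℂ} (hf : ContDiff ℝ ∞ f)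
    (hf' : HasCompactSupport f) (hg : ContDiff ℝ ∞ g) (hg' : HasCompactSupport g) :
    ∫ x, conj (Laplacian.laplacian f x) * g x = ∫ x, conj (f x) * Laplacian.laplacian g x := by
  have h := SchwartzMap.integral_bilinear_laplacian_right_eq_left (μ := volume)
    (hf'.toSchwartzMap hf) (hg'.toSchwartzMap hg)
    ((ContinuousLinearMap.mul ℝ ℂ).comp (Complex.conjCLE : ℂ →L[ℝ] ℂ))
  simp only [SchwartzMap.laplacian_apply] at h
  exact h.symm

lemma symmetricOnTest_schrodingerOp (hU : Continuous U) : SymmetricOnTest (schrodingerOp U) where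
  memLp _ := memLp_schrodingerOp hU
  symm f g hf hf' hg hg' := by
    have hfL : MemLp f 2 volume := hf.continuous.memLp_of_hasCompactSupport hf'
    have hgL : MemLp g 2 volume := hg.continuous.memLp_of_hasCompactSupport hg'
    have hΔ {f : Euc m → ℂ} (hf : ContDiff ℝ ∞ f) (hf' : HasCompactSupport f) :
        MemLp (Laplacian.laplacian f) 2 volume := by
      have h := memLp_schrodingerOp (U := 0) continuous_zero hf hf'
      -- With zero potential the operator is `-½ Δ`, so the factor `-2` recovers `Δ`.
      convert h.const_mul (-2 : ℂ) using 1
      ext x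
      simp [schrodingerOp]
    have hUf : Integrable fun x => conj (f x) * ((U x : ℂ) * g x) := by
      refine integrable_conj_mul hfL (Continuous.memLp_of_hasCompactSupport ?_ hg'.mul_left)
      have := hg.continuous
      fun_prop
    have h₁ := (integrable_conj_mul (hΔ hf hf') hgL).const_mul (-(1 / 2 : ℂ))
    have h₂ := (integrable_conj_mul hfL (hΔ hg hg')).const_mul (-(1 / 2 : ℂ))
    have e₁ x : conj (schrodingerOp U f x) * g x = -(1 / 2 : ℂ) *
        (conj (Laplacian.laplacian f x) * g x) + conj (f x) * ((U x : ℂ) * g x) := by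
      simp only [schrodingerOp, map_add, map_mul, map_neg, map_div₀, map_one, Complex.conj_ofReal,
        map_ofNat]
      ring
    have e₂ x : conj (f x) * schrodingerOp U g x = -(1 / 2 : ℂ) *
        (conj (f x) * Laplacian.laplacian g x) + conj (f x) * ((U x : ℂ) * g x) := by
      simp only [schrodingerOp]
      ring
    simp only [e₁, e₂]
    rw [integral_add h₁ hUf, integral_add h₂ hUf, integral_const_mul, integral_const_mul,
      integral_conj_laplacian_mul hf hf' hg hg']

end OneVariable

/-! ### Operators on the product space, treated by slicing -/

section TwoVariables

variable {n d : ℕ} {U₁ : Euc n → ℝ} {U₂ : Euc d → ℝ}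

/-- The Schrödinger operator in the first variable. -/
def schrodingerFst (U : Euc n → ℝ) (f : Euc n × Euc d → ℂ) (z : Euc n × Euc d) : ℂ :=
  schrodingerOp U (fun x => f (x, z.2)) z.1

/-- The Schrödinger operator in the second variable. -/
def schrodingerSnd (U : Euc d → ℝ) (f : Euc n × Euc d → ℂ) (z : Euc n × Euc d) : ℂ :=
  schrodingerOp U (fun y => f (z.1, y)) z.2

lemma schrodingerFst_eq (U : Euc n → ℝ) {f : Euc n × Euc d → ℂ} (hf : ContDiff ℝ ∞ f) :
    schrodingerFst U f = fun z => -(1 / 2 : ℂ) *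
      partialLaplacian (ContinuousLinearMap.inl ℝ (Euc n) (Euc d)) f z + (U z.1 : ℂ) * f z := by
  ext ⟨x, y⟩
  have := laplacian_comp_affine (ContinuousLinearMap.inl ℝ (Euc n) (Euc d)) hf (0, y) x
  simp only [ContinuousLinearMap.inl_apply, Prod.mk_add_mk, zero_add, add_zero] at this
  simp only [schrodingerFst, schrodingerOp, this]

lemma schrodingerSnd_eq (U : Euc d → ℝ) {f : Euc n × Euc d → ℂ} (hf : ContDiff ℝ ∞ f) :
    schrodingerSnd U f = fun z => -(1 / 2 : ℂ) *
      partialLaplacian (ContinuousLinearMap.inr ℝ (Euc n) (Euc d)) f z + (U z.2 : ℂ) * f z := by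
  ext ⟨x, y⟩
  have := laplacian_comp_affine (ContinuousLinearMap.inr ℝ (Euc n) (Euc d)) hf (x, 0) y
  simp only [ContinuousLinearMap.inr_apply, Prod.mk_add_mk, zero_add, add_zero] at this
  simp only [schrodingerSnd, schrodingerOp, this]

lemma memLp_schrodingerFst (hU : Continuous U₁) {f : Euc n × Euc d → ℂ} (hf : ContDiff ℝ ∞ f)
    (hf' : HasCompactSupport f) : MemLp (schrodingerFst U₁ f) 2 volume := by
  rw [schrodingerFst_eq U₁ hf]
  refine Continuous.memLp_of_hasCompactSupport ?_
    ((hasCompactSupport_partialLaplacian _ hf').mul_left.add hf'.mul_left)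
  have := continuous_partialLaplacian (ContinuousLinearMap.inl ℝ (Euc n) (Euc d)) hf
  have := hf.continuous
  fun_prop

lemma memLp_schrodingerSnd (hU : Continuous U₂) {f : Euc n × Euc d → ℂ} (hf : ContDiff ℝ ∞ f)
    (hf' : HasCompactSupport f) : MemLp (schrodingerSnd U₂ f) 2 volume := by
  rw [schrodingerSnd_eq U₂ hf]
  refine Continuous.memLp_of_hasCompactSupport ?_
    ((hasCompactSupport_partialLaplacian _ hf').mul_left.add hf'.mul_left)
  have := continuous_partialLaplacian (ContinuousLinearMap.inr ℝ (Euc n) (Euc d)) hf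
  have := hf.continuous
  fun_prop

lemma contDiff_slice_fst {f : Euc n × Euc d → ℂ} (hf : ContDiff ℝ ∞ f) (y : Euc d) :
    ContDiff ℝ ∞ fun x => f (x, y) :=
  hf.comp (contDiff_prodMk_left y)

lemma contDiff_slice_snd {f : Euc n × Euc d → ℂ} (hf : ContDiff ℝ ∞ f) (x : Euc n) :
    ContDiff ℝ ∞ fun y => f (x, y) :=
  hf.comp (contDiff_prodMk_right x)

lemma hasCompactSupport_slice_fst {f : Euc n × Euc d → ℂ} (hf : HasCompactSupport f) (y : Euc d) :
    HasCompactSupport fun x => f (x, y) :=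
  HasCompactSupport.intro (hf.isCompact.image continuous_fst) fun x hx =>
    image_eq_zero_of_notMem_tsupport fun h => hx ⟨(x, y), h, rfl⟩

lemma hasCompactSupport_slice_snd {f : Euc n × Euc d → ℂ} (hf : HasCompactSupport f) (x : Euc n) :
    HasCompactSupport fun y => f (x, y) :=
  HasCompactSupport.intro (hf.isCompact.image continuous_snd) fun y hy =>
    image_eq_zero_of_notMem_tsupport fun h => hy ⟨(x, y), h, rfl⟩

/-- Fubini: for frozen `y`, the slice of a test function is a test function in `x`, so a
one-variable identity suffices. -/
lemma integral_conj_schrodingerFst_mul (hU : Continuous U₁) {f P Q : Euc n × Euc d → ℂ}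
    (hf : ContDiff ℝ ∞ f) (hf' : HasCompactSupport f) (hP : MemLp P 2 volume)
    (hQ : MemLp Q 2 volume)
    (h : ∀ y, ∀ g : Euc n → ℂ, ContDiff ℝ ∞ g → HasCompactSupport g →
      ∫ x, conj (schrodingerOp U₁ g x) * P (x, y) = ∫ x, conj (g x) * Q (x, y)) :
    ∫ z, conj (schrodingerFst U₁ f z) * P z = ∫ z, conj (f z) * Q z := by
  have hfL : MemLp f 2 volume := hf.continuous.memLp_of_hasCompactSupport hf'
  have i₁ := integrable_conj_mul (memLp_schrodingerFst hU hf hf') hP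
  have i₂ := integrable_conj_mul hfL hQ
  rw [Measure.volume_eq_prod] at i₁ i₂ ⊢
  rw [integral_prod_symm _ i₁, integral_prod_symm _ i₂]
  exact integral_congr_ae (ae_of_all _ fun y =>
    h y (fun x => f (x, y)) (contDiff_slice_fst hf y) (hasCompactSupport_slice_fst hf' y))

lemma integral_conj_schrodingerSnd_mul (hU : Continuous U₂) {f P Q : Euc n × Euc d → ℂ}
    (hf : ContDiff ℝ ∞ f) (hf' : HasCompactSupport f) (hP : MemLp P 2 volume)
    (hQ : MemLp Q 2 volume)
    (h : ∀ x, ∀ g : Euc d → ℂ, ContDiff ℝ ∞ g → HasCompactSupport g →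
      ∫ y, conj (schrodingerOp U₂ g y) * P (x, y) = ∫ y, conj (g y) * Q (x, y)) :
    ∫ z, conj (schrodingerSnd U₂ f z) * P z = ∫ z, conj (f z) * Q z := by
  have hfL : MemLp f 2 volume := hf.continuous.memLp_of_hasCompactSupport hf'
  have i₁ := integrable_conj_mul (memLp_schrodingerSnd hU hf hf') hP
  have i₂ := integrable_conj_mul hfL hQ
  rw [Measure.volume_eq_prod] at i₁ i₂ ⊢
  rw [integral_prod _ i₁, integral_prod _ i₂]
  exact integral_congr_ae (ae_of_all _ fun x =>
    h x (fun y => f (x, y)) (contDiff_slice_snd hf x) (hasCompactSupport_slice_snd hf' x))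

lemma fullHamiltonian_eq (V₁ : Euc n → ℝ) (V₂ : Euc d → ℝ) (W : Euc n → Euc d → ℝ)
    (f : Euc n × Euc d → ℂ) (z : Euc n × Euc d) :
    fullHamiltonian V₁ V₂ W f z
      = schrodingerFst V₁ f z + schrodingerSnd V₂ f z + (W z.1 z.2 : ℂ) * f z := rfl

lemma memLp_mul_of_continuous {w : Euc n × Euc d → ℝ} (hw : Continuous w)
    {f : Euc n × Euc d → ℂ} (hf : Continuous f) (hf' : HasCompactSupport f) :
    MemLp (fun z => (w z : ℂ) * f z) 2 volume :=
  Continuous.memLp_of_hasCompactSupport (by fun_prop) hf'.mul_left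

lemma symmetricOnTest_fullHamiltonian {V₁ : Euc n → ℝ} {V₂ : Euc d → ℝ} {W : Euc n → Euc d → ℝ}
    (hV₁ : Continuous V₁) (hV₂ : Continuous V₂)
    (hW : Continuous fun z : Euc n × Euc d => W z.1 z.2) :
    SymmetricOnTest (fullHamiltonian V₁ V₂ W) where
  memLp f hf hf' := ((memLp_schrodingerFst hV₁ hf hf').add (memLp_schrodingerSnd hV₂ hf hf')).add
    (memLp_mul_of_continuous hW hf.continuous hf')
  symm f g hf hf' hg hg' := by
    have hfL : MemLp f 2 volume := hf.continuous.memLp_of_hasCompactSupport hf'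
    have hgL : MemLp g 2 volume := hg.continuous.memLp_of_hasCompactSupport hg'
    have h₁ := integral_conj_schrodingerFst_mul hV₁ hf hf' hgL (memLp_schrodingerFst hV₁ hg hg')
      fun y k hk hk' => (symmetricOnTest_schrodingerOp hV₁).symm k (fun x => g (x, y)) hk hk'
        (contDiff_slice_fst hg y) (hasCompactSupport_slice_fst hg' y)
    have h₂ := integral_conj_schrodingerSnd_mul hV₂ hf hf' hgL (memLp_schrodingerSnd hV₂ hg hg')
      fun x k hk hk' => (symmetricOnTest_schrodingerOp hV₂).symm k (fun y => g (x, y)) hk hk'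
        (contDiff_slice_snd hg x) (hasCompactSupport_slice_snd hg' x)
    have e₁ z : conj (fullHamiltonian V₁ V₂ W f z) * g z = conj (schrodingerFst V₁ f z) * g z
        + conj (schrodingerSnd V₂ f z) * g z + conj (f z) * ((W z.1 z.2 : ℂ) * g z) := by
      simp only [fullHamiltonian_eq, map_add, map_mul, Complex.conj_ofReal]
      ring
    have e₂ z : conj (f z) * fullHamiltonian V₁ V₂ W g z = conj (f z) * schrodingerFst V₁ g z
        + conj (f z) * schrodingerSnd V₂ g z + conj (f z) * ((W z.1 z.2 : ℂ) * g z) := by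
      simp only [fullHamiltonian_eq]
      ring
    have i₁ := integrable_conj_mul (memLp_schrodingerFst hV₁ hf hf') hgL
    have i₂ := integrable_conj_mul (memLp_schrodingerSnd hV₂ hf hf') hgL
    have i₃ := integrable_conj_mul hfL (memLp_mul_of_continuous hW hg.continuous hg')
    have j₁ := integrable_conj_mul hfL (memLp_schrodingerFst hV₁ hg hg')
    have j₂ := integrable_conj_mul hfL (memLp_schrodingerSnd hV₂ hg hg')
    simp only [e₁, e₂]
    rw [integral_add_add i₁ i₂ i₃, integral_add_add j₁ j₂ i₃, h₁, h₂]

/-- On each slice the factor `w y` is a constant, which leaves the weak equation of `u`. This avoids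
approximating the tensor product by test functions on the product space. -/
lemma integral_conj_schrodingerFst_mul_tensor (hU : Continuous U₁) {u v : L2 (Euc n)}
    (h : InClosure (schrodingerOp U₁) u v) (w : L2 (Euc d)) {f : Euc n × Euc d → ℂ}
    (hf : ContDiff ℝ ∞ f) (hf' : HasCompactSupport f) :
    ∫ z, conj (schrodingerFst U₁ f z) * (u z.1 * w z.2)
      = ∫ z, conj (f z) * (v z.1 * w z.2) := by
  refine integral_conj_schrodingerFst_mul hU hf hf' (memLp_tensor (Lp.memLp u) (Lp.memLp w))
    (memLp_tensor (Lp.memLp v) (Lp.memLp w)) fun y g hg hg' => ?_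
  simp only [← mul_assoc]
  rw [integral_mul_const, integral_mul_const,
    (symmetricOnTest_schrodingerOp hU).integral_eq h hg hg']

lemma integral_conj_schrodingerSnd_mul_tensor (hU : Continuous U₂) {u v : L2 (Euc d)}
    (h : InClosure (schrodingerOp U₂) u v) (w : L2 (Euc n)) {f : Euc n × Euc d → ℂ}
    (hf : ContDiff ℝ ∞ f) (hf' : HasCompactSupport f) :
    ∫ z, conj (schrodingerSnd U₂ f z) * (w z.1 * u z.2)
      = ∫ z, conj (f z) * (w z.1 * v z.2) := by
  refine integral_conj_schrodingerSnd_mul hU hf hf' (memLp_tensor (Lp.memLp w) (Lp.memLp u))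
    (memLp_tensor (Lp.memLp w) (Lp.memLp v)) fun x g hg hg' => ?_
  simp only [mul_left_comm _ (w x)]
  rw [integral_const_mul, integral_const_mul,
    (symmetricOnTest_schrodingerOp hU).integral_eq h hg hg']

end TwoVariables

/-! ### Averages -/

lemma bracket_sq {m : ℕ} (x : Euc m) : bracket x ^ 2 = 1 + ‖x‖ ^ 2 :=
  Real.sq_sqrt (by positivity)

lemma one_le_bracket {m : ℕ} (x : Euc m) : 1 ≤ bracket x :=
  Real.one_le_sqrt.2 (by nlinarith [sq_nonneg ‖x‖])

lemma continuous_bracket {m : ℕ} : Continuous (bracket : Euc m → ℝ) := by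
  unfold bracket
  fun_prop

lemma aestronglyMeasurable_sq_norm {X : Type*} [MeasureSpace X] {φ : X → ℂ}
    (hφ : AEStronglyMeasurable φ volume) : AEStronglyMeasurable (fun x => ‖φ x‖ ^ 2) volume :=
  hφ.norm.pow 2

lemma integrable_sq_norm {X : Type*} [MeasureSpace X] (u : L2 X) :
    Integrable fun x => ‖u x‖ ^ 2 :=
  (memLp_two_iff_integrable_sq_norm (Lp.memLp u).1).1 (Lp.memLp u)

lemma integral_sq_norm {X : Type*} [MeasureSpace X] (u : L2 X) : ∫ x, ‖u x‖ ^ 2 = ‖u‖ ^ 2 := by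
  have h : inner ℂ u u = ((∫ x, ‖u x‖ ^ 2 : ℝ) : ℂ) := by
    rw [inner_L2, ← integral_complex_ofReal]
    refine integral_congr_ae (ae_of_all _ fun x => ?_)
    simp only [Complex.conj_mul', Complex.ofReal_pow]
  rw [inner_self_eq_norm_sq_to_K] at h
  refine Complex.ofReal_injective ?_
  rw [← h, Complex.ofReal_pow]
  rfl

lemma ContinuousMoment.integrable {m : ℕ} {u : ℝ → L2 (Euc m)} (h : ContinuousMoment u) {t : ℝ}
    (ht : 0 ≤ t) : Integrable fun x => bracket x ^ 2 * ‖u t x‖ ^ 2 := by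
  obtain ⟨g, -, hg⟩ := h
  refine ((integrable_sq_norm (u t)).add (integrable_sq_norm (g t))).congr ?_
  filter_upwards [hg t ht] with x hx
  simp only [Pi.add_apply, hx, bracket_sq, norm_mul, Complex.norm_real, norm_norm]
  ring

/-! ### Averages of the coupling under the quadratic growth bound -/

section Coupling

variable {n d : ℕ} {W : Euc n → Euc d → ℝ} {C : ℝ}

lemma continuous_avg_coupling (hW : Continuous fun z : Euc n × Euc d => W z.1 z.2) (hC₀ : 0 ≤ C)
    (hC : ∀ x y, |W x y| ≤ C * bracket x ^ 2 * bracket y ^ 2) (φ : L2 (Euc d))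
    (hφ : Integrable fun y => bracket y ^ 2 * ‖φ y‖ ^ 2) :
    Continuous fun x => avg (fun y => W x y) φ := by
  refine Continuous.div_const (continuous_iff_continuousAt.2 fun x₀ => ?_) _
  refine continuousAt_of_dominated
    (bound := fun y => C * (bracket x₀ ^ 2 + 1) * (bracket y ^ 2 * ‖φ y‖ ^ 2))
    (Eventually.of_forall fun x => ?_) ?_ (hφ.const_mul _) (ae_of_all _ fun y => ?_)
  · exact (hW.comp (Continuous.prodMk_right x)).aestronglyMeasurable.mul
      (aestronglyMeasurable_sq_norm (Lp.memLp φ).1)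
  · have hb : ∀ᶠ x in 𝓝 x₀, bracket x ^ 2 < bracket x₀ ^ 2 + 1 :=
      (continuous_bracket.pow 2).continuousAt.eventually_lt_const (lt_add_one _)
    filter_upwards [hb] with x hx
    refine ae_of_all _ fun y => ?_
    rw [norm_mul, Real.norm_eq_abs, Real.norm_of_nonneg (sq_nonneg ‖φ y‖), ← mul_assoc]
    refine mul_le_mul_of_nonneg_right ((hC x y).trans ?_) (sq_nonneg _)
    gcongr
  · exact ((hW.comp (Continuous.prodMk_left y)).mul continuous_const).continuousAt

lemma integrable_coupling (hW : Continuous fun z : Euc n × Euc d => W z.1 z.2)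
    (hC : ∀ x y, |W x y| ≤ C * bracket x ^ 2 * bracket y ^ 2) {φ : L2 (Euc n)} {χ : L2 (Euc d)}
    (hφ : Integrable fun x => bracket x ^ 2 * ‖φ x‖ ^ 2)
    (hχ : Integrable fun y => bracket y ^ 2 * ‖χ y‖ ^ 2) :
    Integrable fun z : Euc n × Euc d => W z.1 z.2 * (‖φ z.1‖ ^ 2 * ‖χ z.2‖ ^ 2) := by
  refine ((hφ.mul_prod hχ).const_mul C).mono'
    (hW.aestronglyMeasurable.mul ((aestronglyMeasurable_sq_norm (Lp.memLp φ).1).comp_fst.mul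
      (aestronglyMeasurable_sq_norm (Lp.memLp χ).1).comp_snd)) (ae_of_all _ fun z => ?_)
  rw [norm_mul, Real.norm_eq_abs, Real.norm_of_nonneg (by positivity : 0 ≤ ‖φ z.1‖ ^ 2 * ‖χ z.2‖ ^ 2)]
  refine (mul_le_mul_of_nonneg_right (hC z.1 z.2) (by positivity)).trans (le_of_eq ?_)
  ring

lemma integrable_coupling_snd (hW : Continuous fun z : Euc n × Euc d => W z.1 z.2)
    (hC : ∀ x y, |W x y| ≤ C * bracket x ^ 2 * bracket y ^ 2) {χ : L2 (Euc d)}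
    (hχ : Integrable fun y => bracket y ^ 2 * ‖χ y‖ ^ 2) (x : Euc n) :
    Integrable fun y => W x y * ‖χ y‖ ^ 2 := by
  refine (hχ.const_mul (C * bracket x ^ 2)).mono'
    ((hW.comp (Continuous.prodMk_right x)).aestronglyMeasurable.mul
      (aestronglyMeasurable_sq_norm (Lp.memLp χ).1)) (ae_of_all _ fun y => ?_)
  rw [norm_mul, Real.norm_eq_abs, Real.norm_of_nonneg (sq_nonneg ‖χ y‖), ← mul_assoc]
  exact mul_le_mul_of_nonneg_right (hC x y) (sq_nonneg _)

/-- Fubini in numerator and denominator. The iterated quotients agree also when a denominator is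
zero, since `div_div` is unconditional. -/
lemma avg_tensor_eq (hW : Continuous fun z : Euc n × Euc d => W z.1 z.2)
    (hC : ∀ x y, |W x y| ≤ C * bracket x ^ 2 * bracket y ^ 2) {φ : L2 (Euc n)} {χ : L2 (Euc d)}
    (hφ : Integrable fun x => bracket x ^ 2 * ‖φ x‖ ^ 2)
    (hχ : Integrable fun y => bracket y ^ 2 * ‖χ y‖ ^ 2) :
    avg (fun z : Euc n × Euc d => W z.1 z.2) (fun z => φ z.1 * χ z.2)
      = avg (fun x => avg (fun y => W x y) χ) φ := by
  have h₁ : ∫ z : Euc n × Euc d, W z.1 z.2 * ‖φ z.1 * χ z.2‖ ^ 2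
      = ∫ x, (∫ y, W x y * ‖χ y‖ ^ 2) * ‖φ x‖ ^ 2 := by
    have hi := integrable_coupling hW hC hφ hχ
    simp only [norm_mul, mul_pow]
    rw [Measure.volume_eq_prod] at hi ⊢
    rw [integral_prod _ hi]
    refine integral_congr_ae (ae_of_all _ fun x => ?_)
    simp only [mul_left_comm _ (‖φ x‖ ^ 2), integral_const_mul]
    rw [mul_comm]
  have h₂ : ∫ z : Euc n × Euc d, ‖φ z.1 * χ z.2‖ ^ 2 = (∫ x, ‖φ x‖ ^ 2) * ∫ y, ‖χ y‖ ^ 2 := by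
    simp only [norm_mul, mul_pow]
    rw [Measure.volume_eq_prod, integral_prod_mul (fun x => ‖φ x‖ ^ 2) fun y => ‖χ y‖ ^ 2]
  simp only [avg]
  rw [h₁, h₂]
  simp only [div_mul_eq_mul_div, integral_div]
  rw [div_div, mul_comm (∫ x, ‖φ x‖ ^ 2)]

/-- The quotient `w = W / (⟨x⟩²⟨y⟩²)` is bounded, and `⟨x⟩²⟨y⟩²|φχ|²` expands into the squares of
four tensors built from `φ`, `|x|φ` and `χ`, `|y|χ`, all continuous in time with values in `L²`. -/
lemma continuousOn_integral_coupling (hW : Continuous fun z : Euc n × Euc d => W z.1 z.2)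
    (hC : ∀ x y, |W x y| ≤ C * bracket x ^ 2 * bracket y ^ 2) {φ : ℝ → L2 (Euc n)}
    {χ : ℝ → L2 (Euc d)} (hφ : ContinuousOn φ (Ici 0)) (hχ : ContinuousOn χ (Ici 0))
    (hφ' : ContinuousMoment φ) (hχ' : ContinuousMoment χ) :
    ContinuousOn (fun t => ∫ z : Euc n × Euc d, W z.1 z.2 * ‖φ t z.1 * χ t z.2‖ ^ 2) (Ici 0) := by
  obtain ⟨g, hg, hgφ⟩ := hφ'
  obtain ⟨k, hk, hkχ⟩ := hχ'
  let w : Euc n × Euc d → ℝ := fun z => W z.1 z.2 / (bracket z.1 ^ 2 * bracket z.2 ^ 2)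
  have hpos (z : Euc n × Euc d) : 0 < bracket z.1 ^ 2 * bracket z.2 ^ 2 := by
    have h₁ := one_le_bracket z.1
    have h₂ := one_le_bracket z.2
    positivity
  have hw : Continuous w :=
    hW.div (((continuous_bracket.comp continuous_fst).pow 2).mul
      ((continuous_bracket.comp continuous_snd).pow 2)) fun z => (hpos z).ne'
  have hwC (z : Euc n × Euc d) : |w z| ≤ C := by
    rw [abs_div, abs_of_pos (hpos z), div_le_iff₀ (hpos z), ← mul_assoc]
    exact hC _ _
  have hc {a : ℝ → L2 (Euc n)} {b : ℝ → L2 (Euc d)} (ha : ContinuousOn a (Ici 0))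
      (hb : ContinuousOn b (Ici 0)) :
      ContinuousOn (fun t => ∫ z, w z * ‖tensor (a t) (b t) z‖ ^ 2) (Ici 0) :=
    (continuous_integral_mul_sq hw.aestronglyMeasurable hwC).comp_continuousOn (continuousOn_tensor ha hb)
  have hi (u : L2 (Euc n × Euc d)) : Integrable fun z => w z * ‖u z‖ ^ 2 :=
    (integrable_sq_norm u).bdd_mul hw.aestronglyMeasurable (ae_of_all _ hwC)
  refine ((((hc hφ hχ).add (hc hφ hk)).add (hc hg hχ)).add (hc hg hk)).congr fun t ht => ?_
  simp only [Pi.add_apply]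
  rw [← integral_add_add (hi _) (hi _) (hi _)]
  refine Eq.trans ?_ (integral_add (((hi _).add (hi _)).add (hi _)) (hi _))
  refine integral_congr_ae ?_
  filter_upwards [coeFn_tensor (φ t) (χ t), coeFn_tensor (φ t) (k t), coeFn_tensor (g t) (χ t),
    coeFn_tensor (g t) (k t), ae_fst (Y := Euc d) (hgφ t ht), ae_snd (X := Euc n) (hkχ t ht)]
    with z h₁ h₂ h₃ h₄ h₅ h₆
  have h : W z.1 z.2 = w z * (bracket z.1 ^ 2 * bracket z.2 ^ 2) :=
    (div_mul_cancel₀ _ (hpos z).ne').symm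
  simp only [h₁, h₂, h₃, h₄, h₅, h₆, norm_mul, Complex.norm_real, norm_norm]
  rw [h, bracket_sq, bracket_sq]
  ring

lemma integral_sq_norm_tensor (φ : L2 (Euc n)) (χ : L2 (Euc d)) :
    ∫ z : Euc n × Euc d, ‖φ z.1 * χ z.2‖ ^ 2 = ‖φ‖ ^ 2 * ‖χ‖ ^ 2 := by
  rw [← mul_pow, ← norm_tensor, ← integral_sq_norm]
  refine integral_congr_ae ?_
  filter_upwards [coeFn_tensor φ χ] with z hz
  rw [hz]

end Coupling

lemma hasDerivWithinAt_integral_of_continuousOn {F : ℝ → ℝ} (hF : ContinuousOn F (Ici 0)) {t : ℝ}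
    (ht : 0 ≤ t) : HasDerivWithinAt (fun t => ∫ s in (0 : ℝ)..t, F s) (F t) (Ici 0) t := by
  -- Extending `F` by `F 0` to negative times gives a continuous function on the line, to which the
  -- two-sided fundamental theorem applies.
  have hc : Continuous fun s => F (max s 0) :=
    hF.comp_continuous (continuous_id.max continuous_const) fun s => mem_Ici.2 (le_max_right _ _)
  have h := (intervalIntegral.integral_hasDerivAt_right (hc.intervalIntegrable 0 t)
    (hc.stronglyMeasurableAtFilter _ _) hc.continuousAt).hasDerivWithinAt (s := Ici 0)
  simp only [max_eq_left ht] at h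
  have e (r : ℝ) (hr : 0 ≤ r) : ∫ s in (0 : ℝ)..r, F s = ∫ s in (0 : ℝ)..r, F (max s 0) :=
    intervalIntegral.integral_congr fun s hs => by
      rw [uIcc_of_le hr] at hs
      simp only [max_eq_left hs.1]
  exact h.congr (fun r hr => e r hr) (e t ht)

/-! ### The energy estimate in a Hilbert space -/

section Energy

variable {E : Type*} [NormedAddCommGroup E] [InnerProductSpace ℂ E]

/-- Only the continuous `h` has to be measurable, so `B` may be an arbitrary function, with infinite
values allowed. -/
lemma ofReal_intervalIntegral_le {h : ℝ → ℝ} {t : ℝ} (ht : 0 ≤ t) (hh : ContinuousOn h (Icc 0 t))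
    {B : ℝ → ℝ≥0∞} (hB : ∀ s ∈ Icc 0 t, ENNReal.ofReal (h s) ≤ B s) :
    ENNReal.ofReal (∫ s in (0 : ℝ)..t, h s) ≤ ∫⁻ s in Icc 0 t, B s := by
  have hm : ContinuousOn (fun s => max (h s) 0) (Icc 0 t) := hh.sup continuousOn_const
  calc ENNReal.ofReal (∫ s in (0 : ℝ)..t, h s)
      ≤ ENNReal.ofReal (∫ s in (0 : ℝ)..t, max (h s) 0) := by
        refine ENNReal.ofReal_le_ofReal (intervalIntegral.integral_mono_on ht ?_ ?_
          fun s _ => le_max_left _ _)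
        · exact hh.intervalIntegrable_of_Icc ht
        · exact hm.intervalIntegrable_of_Icc ht
    _ = ∫⁻ s in Icc 0 t, ENNReal.ofReal (max (h s) 0) := by
        rw [intervalIntegral.integral_of_le ht, ← integral_Icc_eq_integral_Ioc,
          ofReal_integral_eq_lintegral_ofReal (hm.integrableOn_Icc)
            (ae_of_all _ fun s => le_max_right _ _)]
    _ ≤ ∫⁻ s in Icc 0 t, B s := by
        refine setLIntegral_mono' measurableSet_Icc fun s hs => ?_
        rw [ENNReal.ofReal_max, ENNReal.ofReal_zero, max_eq_left zero_le]
        exact hB s hs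

lemma enorm_le_lintegral_of_re_inner_le {r r' : ℝ → E} (hr' : ContinuousOn r' (Ici 0))
    (hr : ∀ t, 0 ≤ t → HasDerivWithinAt r (r' t) (Ici 0) t) (h₀ : r 0 = 0) {B : ℝ → ℝ≥0∞}
    (hB : ∀ s, 0 ≤ s → B s ≠ ⊤ → (inner ℂ (r s) (r' s)).re ≤ ‖r s‖ * (B s).toReal) {t : ℝ}
    (ht : 0 ≤ t) : ‖r t‖ₑ ≤ ∫⁻ s in Icc 0 t, B s := by
  let _ : InnerProductSpace ℝ E := InnerProductSpace.rclikeToReal ℂ E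
  have hrc : ContinuousOn r (Ici 0) := fun s hs => (hr s hs).continuousWithinAt
  refine ENNReal.le_of_forall_pos_le_add fun ε hε _ => ?_
  have hε' : (0 : ℝ) < ε := hε
  -- The norm need not be differentiable where `r` vanishes. This regularization is, it starts at
  -- `ε`, and since `‖r‖ ≤ G` its derivative stays below `B`.
  let G : ℝ → ℝ := fun s => Real.sqrt (‖r s‖ ^ 2 + (ε : ℝ) ^ 2)
  have hpos (s : ℝ) : 0 < ‖r s‖ ^ 2 + (ε : ℝ) ^ 2 := by positivity
  have hGpos (s : ℝ) : 0 < G s := Real.sqrt_pos.2 (hpos s)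
  have hrG (s : ℝ) : ‖r s‖ ≤ G s :=
    Real.le_sqrt_of_sq_le (by nlinarith [sq_nonneg (ε : ℝ)])
  let h : ℝ → ℝ := fun s => (inner ℂ (r s) (r' s)).re / G s
  have hd (s : ℝ) (hs : 0 ≤ s) : HasDerivWithinAt G (h s) (Ici 0) s := by
    have h₁ := ((hr s hs).norm_sq.add_const ((ε : ℝ) ^ 2)).sqrt (hpos s).ne'
    convert h₁ using 1
    rw [real_inner_eq_re_inner ℂ, RCLike.re_eq_complex_re, mul_div_mul_left _ _ two_ne_zero]
  have hGc : ContinuousOn G (Ici 0) := fun s hs => (hd s hs).continuousWithinAt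
  have hhc : ContinuousOn h (Icc 0 t) :=
    ((Complex.continuous_re.comp_continuousOn (hrc.inner hr')).div hGc
      fun s _ => (hGpos s).ne').mono Icc_subset_Ici_self
  have hFTC : ∫ s in (0 : ℝ)..t, h s = G t - G 0 :=
    intervalIntegral.integral_eq_sub_of_hasDerivAt_of_le ht (hGc.mono Icc_subset_Ici_self)
      (fun s hs => (hd s hs.1.le).hasDerivAt (Ici_mem_nhds hs.1))
      (hhc.intervalIntegrable_of_Icc ht)
  have hG₀ : G 0 = ε := by
    simp [G, h₀]
  have hle := ofReal_intervalIntegral_le ht hhc (B := B) fun s hs => by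
    by_cases hBs : B s = ⊤
    · simp [hBs]
    · refine ENNReal.ofReal_le_of_le_toReal ((div_le_iff₀ (hGpos s)).2 ?_)
      rw [mul_comm]
      exact (hB s hs.1 hBs).trans (mul_le_mul_of_nonneg_right (hrG s) ENNReal.toReal_nonneg)
  rw [hFTC, hG₀] at hle
  calc ‖r t‖ₑ ≤ ENNReal.ofReal ((G t - ε) + ε) := by
        rw [sub_add_cancel, ← ofReal_norm]
        exact ENNReal.ofReal_le_ofReal (hrG t)
    _ ≤ ENNReal.ofReal (G t - ε) + ENNReal.ofReal ε := ENNReal.ofReal_add_le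
    _ ≤ (∫⁻ s in Icc 0 t, B s) + ε := by
        rw [ENNReal.ofReal_coe_nnreal]
        gcongr

/-- Expanding `Re⟨ψ - a, ψ' - a'⟩`, the diagonal terms vanish and the imaginary part of `h` turns
the cross terms into `Im⟨ψ, S⟩`. This equals `Im⟨ψ - a, S⟩` by `hS`, and Cauchy–Schwarz concludes.
-/
lemma re_inner_sub_le {ψ ψ' a a' S : E} (hψ : (inner ℂ ψ ψ').re = 0) (ha : (inner ℂ a a').re = 0)
    (hS : (inner ℂ a S).im = 0)
    (h : inner ℂ (Complex.I • ψ') a = inner ℂ ψ (Complex.I • a' + S)) :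
    (inner ℂ (ψ - a) (ψ' - a')).re ≤ ‖ψ - a‖ * ‖S‖ := by
  have h₁ : (inner ℂ (ψ - a) (ψ' - a')).re = (inner ℂ (ψ - a) S).im := by
    rw [inner_add_right, inner_smul_left, inner_smul_right, Complex.conj_I] at h
    have h₂ := congrArg Complex.im h
    have h₃ : (inner ℂ a ψ').re = (inner ℂ ψ' a).re := by
      rw [← inner_conj_symm, Complex.conj_re]
    simp at h₂
    simp only [inner_sub_left, inner_sub_right, Complex.sub_re, Complex.sub_im]
    linarith
  rw [h₁]
  exact (Complex.im_le_norm _).trans (norm_inner_le_norm _ _)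

end Energy

/-! ### The mean-field approximation solves the Schrödinger equation up to a residual -/

section Residual

variable {n d : ℕ} {V₁ : Euc n → ℝ} {V₂ : Euc d → ℝ} {W : Euc n → Euc d → ℝ}

/-- The fluctuation `(W - ⟨W⟩_y - ⟨W⟩_x + θ) φ χ`. -/
def residual (W : Euc n → Euc d → ℝ) (θ : ℝ) (φ : L2 (Euc n)) (χ : L2 (Euc d))
    (z : Euc n × Euc d) : ℂ :=
  ((W z.1 z.2 - avg (fun y => W z.1 y) χ - avg (fun x => W x z.2) φ + θ : ℝ) : ℂ)
    * (φ z.1 * χ z.2)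

/-- Split `H` as `(H_x + ⟨W⟩_y) + (H_y + ⟨W⟩_x) + w` with `w = W - ⟨W⟩_y - ⟨W⟩_x`. The first two
operators are moved onto the tensor by the Hartree equations, and `w` is a real multiplication. -/
lemma inner_fullHamiltonian_tensor (hV₁ : Continuous V₁) (hV₂ : Continuous V₂)
    (hW : Continuous fun z : Euc n × Euc d => W z.1 z.2) {φ φ' : L2 (Euc n)} {χ χ' : L2 (Euc d)}
    (hA₁ : Continuous fun x => avg (fun y => W x y) χ)
    (hA₂ : Continuous fun y => avg (fun x => W x y) φ)
    (hφ : InClosure (schrodingerOp fun x => V₁ x + avg (fun y => W x y) χ) φ (Complex.I • φ'))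
    (hχ : InClosure (schrodingerOp fun y => V₂ y + avg (fun x => W x y) φ) χ (Complex.I • χ'))
    {θ : ℝ} (hS : MemLp (residual W θ φ χ) 2 volume) {f : Euc n × Euc d → ℂ}
    (hf : ContDiff ℝ ∞ f) (hf' : HasCompactSupport f) :
    ∫ z, conj (fullHamiltonian V₁ V₂ W f z) * tensor φ χ z = ∫ z, conj (f z) *
      (Complex.I • ((Complex.I * θ) • tensor φ χ + (tensor φ χ' + tensor φ' χ)) + hS.toLp _) z := by
  have hfL : MemLp f 2 volume := hf.continuous.memLp_of_hasCompactSupport hf'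
  have hT : MemLp (fun z : Euc n × Euc d => φ z.1 * χ z.2) 2 volume :=
    memLp_tensor (Lp.memLp φ) (Lp.memLp χ)
  have hU₁ : Continuous fun x => V₁ x + avg (fun y => W x y) χ := hV₁.add hA₁
  have hU₂ : Continuous fun y => V₂ y + avg (fun x => W x y) φ := hV₂.add hA₂
  let w : Euc n × Euc d → ℝ := fun z =>
    W z.1 z.2 - avg (fun y => W z.1 y) χ - avg (fun x => W x z.2) φ
  have hw : Continuous w :=
    (hW.sub (hA₁.comp continuous_fst)).sub (hA₂.comp continuous_snd)
  have h₁ := integral_conj_schrodingerFst_mul_tensor hU₁ hφ χ hf hf'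
  have h₂ := integral_conj_schrodingerSnd_mul_tensor hU₂ hχ φ hf hf'
  have i₁ := integrable_conj_mul (memLp_schrodingerFst hU₁ hf hf') hT
  have i₂ := integrable_conj_mul (memLp_schrodingerSnd hU₂ hf hf') hT
  have i₃ := integrable_conj_mul (memLp_mul_of_continuous hw hf.continuous hf') hT
  have j₁ := integrable_conj_mul hfL
    (memLp_tensor (Lp.memLp (Complex.I • φ')) (Lp.memLp χ))
  have j₂ := integrable_conj_mul hfL
    (memLp_tensor (Lp.memLp φ) (Lp.memLp (Complex.I • χ')))
  have e : ∀ᵐ z, conj (fullHamiltonian V₁ V₂ W f z) * tensor φ χ z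
      = conj (schrodingerFst (fun x => V₁ x + avg (fun y => W x y) χ) f z) * (φ z.1 * χ z.2)
        + conj (schrodingerSnd (fun y => V₂ y + avg (fun x => W x y) φ) f z) * (φ z.1 * χ z.2)
        + conj ((w z : ℂ) * f z) * (φ z.1 * χ z.2) := by
    filter_upwards [coeFn_tensor φ χ] with z hz
    rw [hz, ← add_mul, ← add_mul, ← map_add, ← map_add]
    congr 2
    simp only [fullHamiltonian_eq, schrodingerFst, schrodingerSnd, schrodingerOp, w,
      Complex.ofReal_add, Complex.ofReal_sub]
    ring
  rw [integral_congr_ae e, integral_add_add i₁ i₂ i₃, h₁, h₂, ← integral_add_add j₁ j₂ i₃]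
  refine integral_congr_ae ?_
  let T := tensor φ χ
  filter_upwards [coeFn_tensor φ χ, coeFn_tensor φ χ', coeFn_tensor φ' χ, hS.coeFn_toLp,
    ae_fst (Y := Euc d) (Lp.coeFn_smul Complex.I φ'), ae_snd (X := Euc n) (Lp.coeFn_smul Complex.I χ'),
    Lp.coeFn_add (Complex.I • ((Complex.I * θ) • T + (tensor φ χ' + tensor φ' χ))) (hS.toLp _),
    Lp.coeFn_smul Complex.I ((Complex.I * θ) • T + (tensor φ χ' + tensor φ' χ)),
    Lp.coeFn_add ((Complex.I * (θ : ℂ)) • T) (tensor φ χ' + tensor φ' χ),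
    Lp.coeFn_smul (Complex.I * (θ : ℂ)) T, Lp.coeFn_add (tensor φ χ') (tensor φ' χ)]
    with z k₁ k₂ k₃ k₄ k₅ k₆ k₇ k₈ k₉ l₁ l₂
  rw [k₇, Pi.add_apply, k₈, Pi.smul_apply, k₉, Pi.add_apply, l₁, Pi.smul_apply, l₂, Pi.add_apply,
    k₁, k₂, k₃, k₄, k₅, k₆]
  simp only [Pi.smul_apply, smul_eq_mul, residual, w, map_mul, map_sub, Complex.conj_ofReal,
    Complex.ofReal_add, Complex.ofReal_sub]
  -- The phase contributes `i · iθ = -θ`, which cancels the `+θ` inside the residual.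
  linear_combination (conj (f z) * θ * φ z.1 * χ z.2) * (-Complex.I_mul_I)

lemma im_inner_tensor_residual {θ : ℝ} {φ : L2 (Euc n)} {χ : L2 (Euc d)}
    (hS : MemLp (residual W θ φ χ) 2 volume) :
    (inner ℂ (tensor φ χ) (hS.toLp _)).im = 0 := by
  have h : inner ℂ (tensor φ χ) (hS.toLp _) = ((∫ z : Euc n × Euc d,
      (W z.1 z.2 - avg (fun y => W z.1 y) χ - avg (fun x => W x z.2) φ + θ)
        * ‖φ z.1 * χ z.2‖ ^ 2 : ℝ) : ℂ) := by
    rw [inner_L2, ← integral_complex_ofReal]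
    refine integral_congr_ae ?_
    filter_upwards [coeFn_tensor φ χ, hS.coeFn_toLp] with z h₁ h₂
    rw [h₁, h₂, residual, mul_left_comm, Complex.conj_mul']
    push_cast
    ring
  rw [h, Complex.ofReal_im]

end Residual

/-! ### The error is bounded by the time integral of the residual -/

section Error

variable {n d : ℕ} {V₁ : Euc n → ℝ} {V₂ : Euc d → ℝ} {W : Euc n → Euc d → ℝ}
  {φ₀x : Euc n → ℂ} {φ₀y : Euc d → ℂ} {ψ : ℝ → L2 (Euc n × Euc d)}
  {φx : ℝ → L2 (Euc n)} {φy : ℝ → L2 (Euc d)}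

lemma Setting.continuous (h : Setting V₁ V₂ W φ₀x φ₀y ψ φx φy) :
    Continuous fun z : Euc n × Euc d => W z.1 z.2 :=
  h.smooth.continuous

lemma Setting.exists_bound (h : Setting V₁ V₂ W φ₀x φ₀y ψ φx φy) :
    ∃ C : ℝ, 0 ≤ C ∧ ∀ x y, |W x y| ≤ C * bracket x ^ 2 * bracket y ^ 2 := by
  obtain ⟨C, hC⟩ := h.growth
  refine ⟨|C|, abs_nonneg C, fun x y => (hC x y).trans ?_⟩
  gcongr
  exact le_abs_self C

lemma Setting.integrable_x (h : Setting V₁ V₂ W φ₀x φ₀y ψ φx φy) {t : ℝ} (ht : 0 ≤ t) :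
    Integrable fun x => bracket x ^ 2 * ‖φx t x‖ ^ 2 :=
  h.hartree.moment_x.integrable ht

lemma Setting.integrable_y (h : Setting V₁ V₂ W φ₀x φ₀y ψ φx φy) {t : ℝ} (ht : 0 ≤ t) :
    Integrable fun y => bracket y ^ 2 * ‖φy t y‖ ^ 2 :=
  h.hartree.moment_y.integrable ht

lemma Setting.continuous_avg_y (h : Setting V₁ V₂ W φ₀x φ₀y ψ φx φy) {t : ℝ} (ht : 0 ≤ t) :
    Continuous fun x => avg (fun y => W x y) (φy t) := by
  obtain ⟨C, hC₀, hC⟩ := h.exists_bound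
  exact continuous_avg_coupling h.continuous hC₀ hC _ (h.integrable_y ht)

lemma Setting.continuous_avg_x (h : Setting V₁ V₂ W φ₀x φ₀y ψ φx φy) {t : ℝ} (ht : 0 ≤ t) :
    Continuous fun y => avg (fun x => W x y) (φx t) := by
  obtain ⟨C, hC₀, hC⟩ := h.exists_bound
  refine continuous_avg_coupling (W := fun y x => W x y) (h.continuous.comp continuous_swap) hC₀
    (fun y x => ?_) _ (h.integrable_x ht)
  rw [mul_right_comm]
  exact hC x y

lemma Setting.norm_x (hV₁ : Continuous V₁) (h : Setting V₁ V₂ W φ₀x φ₀y ψ φx φy) {t : ℝ}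
    (ht : 0 ≤ t) : ‖φx t‖ = ‖φx 0‖ := by
  obtain ⟨φ', -, hφ⟩ := h.hartree.solves_x.evol
  exact norm_eq_of_hasDerivWithinAt (fun s hs => (hφ s hs).1) (fun s hs =>
    (symmetricOnTest_schrodingerOp (hV₁.add (h.continuous_avg_y hs))).re_inner_eq_zero
      (hφ s hs).2) ht

lemma Setting.norm_y (hV₂ : Continuous V₂) (h : Setting V₁ V₂ W φ₀x φ₀y ψ φx φy) {t : ℝ}
    (ht : 0 ≤ t) : ‖φy t‖ = ‖φy 0‖ := by
  obtain ⟨φ', -, hφ⟩ := h.hartree.solves_y.evol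
  exact norm_eq_of_hasDerivWithinAt (fun s hs => (hφ s hs).1) (fun s hs =>
    (symmetricOnTest_schrodingerOp (hV₂.add (h.continuous_avg_x hs))).re_inner_eq_zero
      (hφ s hs).2) ht

lemma eLpNorm_eq_of_norm_eq {X : Type*} [MeasureSpace X] {u v : L2 X} {f : X → ℂ}
    (h : ‖u‖ = ‖v‖) (hv : ∀ᵐ x, v x = f x) : eLpNorm u 2 volume = eLpNorm f 2 volume := by
  rw [← eLpNorm_congr_ae hv, ← Lp.enorm_def, ← Lp.enorm_def, ← ofReal_norm, h, ofReal_norm]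

lemma Setting.eLpNorm_x (hV₁ : Continuous V₁) (h : Setting V₁ V₂ W φ₀x φ₀y ψ φx φy) {t : ℝ}
    (ht : 0 ≤ t) : eLpNorm (φx t) 2 volume = eLpNorm φ₀x 2 volume :=
  eLpNorm_eq_of_norm_eq (h.norm_x hV₁ ht) h.hartree.solves_x.init

lemma Setting.eLpNorm_y (hV₂ : Continuous V₂) (h : Setting V₁ V₂ W φ₀x φ₀y ψ φx φy) {t : ℝ}
    (ht : 0 ≤ t) : eLpNorm (φy t) 2 volume = eLpNorm φ₀y 2 volume :=
  eLpNorm_eq_of_norm_eq (h.norm_y hV₂ ht) h.hartree.solves_y.init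

lemma Setting.fullAvg_eq (h : Setting V₁ V₂ W φ₀x φ₀y ψ φx φy) {t : ℝ} (ht : 0 ≤ t) :
    fullAvg W φx φy t = avg (fun x => avg (fun y => W x y) (φy t)) (φx t) := by
  obtain ⟨C, -, hC⟩ := h.exists_bound
  exact avg_tensor_eq h.continuous hC (h.integrable_x ht) (h.integrable_y ht)

lemma Setting.continuousOn_x (h : Setting V₁ V₂ W φ₀x φ₀y ψ φx φy) : ContinuousOn φx (Ici 0) := by
  obtain ⟨φ', -, hφ⟩ := h.hartree.solves_x.evol
  exact fun s hs => (hφ s hs).1.continuousWithinAt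

lemma Setting.continuousOn_y (h : Setting V₁ V₂ W φ₀x φ₀y ψ φx φy) : ContinuousOn φy (Ici 0) := by
  obtain ⟨φ', -, hφ⟩ := h.hartree.solves_y.evol
  exact fun s hs => (hφ s hs).1.continuousWithinAt

/-- Conservation of both norms makes the denominator constant in time, so only the numerator has to
be continuous, even for vanishing data. -/
lemma Setting.continuousOn_fullAvg (hV₁ : Continuous V₁) (hV₂ : Continuous V₂)
    (h : Setting V₁ V₂ W φ₀x φ₀y ψ φx φy) : ContinuousOn (fullAvg W φx φy) (Ici 0) := by
  obtain ⟨C, -, hC⟩ := h.exists_bound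
  refine ((continuousOn_integral_coupling h.continuous hC h.continuousOn_x h.continuousOn_y
    h.hartree.moment_x h.hartree.moment_y).div_const (‖φx 0‖ ^ 2 * ‖φy 0‖ ^ 2)).congr
    fun t ht => ?_
  rw [fullAvg, avg, integral_sq_norm_tensor, h.norm_x hV₁ ht, h.norm_y hV₂ ht]

lemma Setting.aestronglyMeasurable_residual (h : Setting V₁ V₂ W φ₀x φ₀y ψ φx φy) {t : ℝ}
    (ht : 0 ≤ t) (θ : ℝ) : AEStronglyMeasurable (residual W θ (φx t) (φy t)) volume := by
  have hc : Continuous fun z : Euc n × Euc d =>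
      W z.1 z.2 - avg (fun y => W z.1 y) (φy t) - avg (fun x => W x z.2) (φx t) + θ :=
    ((h.continuous.sub ((h.continuous_avg_y ht).comp continuous_fst)).sub
      ((h.continuous_avg_x ht).comp continuous_snd)).add continuous_const
  exact (Complex.continuous_ofReal.comp hc).aestronglyMeasurable.mul
    (aestronglyMeasurable_tensor (Lp.memLp (φx t)).1 (Lp.memLp (φy t)).1)

/-- The error is at most the time integral of the norm of the fluctuation. -/
theorem Setting.meanFieldError_le (hV₁ : Continuous V₁) (hV₂ : Continuous V₂)
    (h : Setting V₁ V₂ W φ₀x φ₀y ψ φx φy) {B : ℝ → ℝ≥0∞}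
    (hB : ∀ s, 0 ≤ s → eLpNorm (residual W (fullAvg W φx φy s) (φx s) (φy s)) 2 volume ≤ B s)
    {t : ℝ} (ht : 0 ≤ t) : meanFieldError W ψ φx φy t ≤ ∫⁻ s in Icc 0 t, B s := by
  obtain ⟨ψ', hψ'c, hψ'⟩ := h.exact.evol
  obtain ⟨φx', hφx'c, hφx'⟩ := h.hartree.solves_x.evol
  obtain ⟨φy', hφy'c, hφy'⟩ := h.hartree.solves_y.evol
  have hθc := h.continuousOn_fullAvg hV₁ hV₂
  let θ : ℝ → ℝ := fullAvg W φx φy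
  let Θ : ℝ → ℝ := fun t => ∫ s in (0 : ℝ)..t, θ s
  let c : ℝ → ℂ := fun t => Complex.exp (Complex.I * (Θ t : ℂ))
  let T : ℝ → L2 (Euc n × Euc d) := fun t => tensor (φx t) (φy t)
  let D : ℝ → L2 (Euc n × Euc d) := fun t =>
    (Complex.I * (θ t : ℂ)) • T t + (tensor (φx t) (φy' t) + tensor (φx' t) (φy t))
  have hΘ (s : ℝ) (hs : 0 ≤ s) : HasDerivWithinAt Θ (θ s) (Ici 0) s :=
    hasDerivWithinAt_integral_of_continuousOn hθc hs
  have hc (s : ℝ) (hs : 0 ≤ s) : HasDerivWithinAt c (c s * (Complex.I * θ s)) (Ici 0) s :=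
    ((hΘ s hs).ofReal_comp.const_mul Complex.I).cexp
  have hT (s : ℝ) (hs : 0 ≤ s) :
      HasDerivWithinAt T (tensor (φx s) (φy' s) + tensor (φx' s) (φy s)) (Ici 0) s :=
    tensorL.hasDerivWithinAt_of_bilinear (hφx' s hs).1 (hφy' s hs).1
  have hcn (s : ℝ) : conj (c s) * c s = 1 := by
    rw [Complex.conj_mul', Complex.norm_exp_I_mul_ofReal]
    norm_num
  have ha (s : ℝ) (hs : 0 ≤ s) : HasDerivWithinAt (fun s => c s • T s) (c s • D s) (Ici 0) s := by
    refine HasDerivWithinAt.congr_deriv ((hc s hs).smul (hT s hs)) ?_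
    simp only [D, smul_add, smul_smul]
    abel
  have hTc : ContinuousOn T (Ici 0) := fun s hs => (hT s hs).continuousWithinAt
  have hcc : ContinuousOn c (Ici 0) := fun s hs => (hc s hs).continuousWithinAt
  have hDc : ContinuousOn D (Ici 0) :=
    ((continuousOn_const.mul (Complex.continuous_ofReal.comp_continuousOn hθc)).smul hTc).add
      ((continuousOn_tensor h.continuousOn_x hφy'c).add
        (continuousOn_tensor hφx'c h.continuousOn_y))
  have hr₀ : ψ 0 - c 0 • T 0 = 0 := by
    have hc₀ : c 0 = 1 := by simp [c, Θ]
    rw [hc₀, one_smul, sub_eq_zero]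
    refine Lp.ext ?_
    filter_upwards [h.exact.init, coeFn_tensor (φx 0) (φy 0),
      ae_fst (Y := Euc d) h.hartree.solves_x.init,
      ae_snd (X := Euc n) h.hartree.solves_y.init] with z h₁ h₂ h₃ h₄
    rw [h₁, h₂, h₃, h₄]
  have herr : meanFieldError W ψ φx φy t = ‖ψ t - c t • T t‖ₑ := by
    rw [Lp.enorm_def]
    refine eLpNorm_congr_ae ?_
    filter_upwards [Lp.coeFn_sub (ψ t) (c t • T t), Lp.coeFn_smul (c t) (T t),
      coeFn_tensor (φx t) (φy t)] with z h₁ h₂ h₃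
    rw [h₁, Pi.sub_apply, h₂, Pi.smul_apply, h₃, smul_eq_mul, mul_comm]
    rfl
  rw [herr]
  refine enorm_le_lintegral_of_re_inner_le (r := fun s => ψ s - c s • T s)
    (r' := fun s => ψ' s - c s • D s) (hψ'c.sub (hcc.smul hDc))
    (fun s hs => (hψ' s hs).1.sub (ha s hs)) hr₀ (fun s hs hBs => ?_) ht
  -- The residual is known to be square integrable only at times with `B s` finite; the other times
  -- impose no condition in the energy estimate.
  have hS : MemLp (residual W (θ s) (φx s) (φy s)) 2 volume :=
    ⟨h.aestronglyMeasurable_residual hs _, (hB s hs).trans_lt (lt_top_iff_ne_top.2 hBs)⟩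
  have hsym := symmetricOnTest_fullHamiltonian hV₁ hV₂ h.continuous
  have hx₀ := (symmetricOnTest_schrodingerOp
    (hV₁.add (h.continuous_avg_y hs))).re_inner_eq_zero (hφx' s hs).2
  have hy₀ := (symmetricOnTest_schrodingerOp
    (hV₂.add (h.continuous_avg_x hs))).re_inner_eq_zero (hφy' s hs).2
  have hinner (p q : L2 (Euc n × Euc d)) : inner ℂ (c s • p) (c s • q) = inner ℂ p q := by
    rw [inner_smul_left, inner_smul_right, ← mul_assoc, hcn, one_mul]
  have hweak : inner ℂ (Complex.I • ψ' s) (T s)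
      = inner ℂ (ψ s) (Complex.I • D s + hS.toLp _) :=
    (hψ' s hs).2.inner_eq hsym.memLp fun f hf hf' =>
      inner_fullHamiltonian_tensor hV₁ hV₂ h.continuous (h.continuous_avg_y hs)
        (h.continuous_avg_x hs) (hφx' s hs).2 (hφy' s hs).2 hS hf hf'
  have hle := re_inner_sub_le (ψ := ψ s) (ψ' := ψ' s) (a := c s • T s) (a' := c s • D s)
    (S := c s • hS.toLp _) (hsym.re_inner_eq_zero (hψ' s hs).2) ?_ ?_ ?_
  · refine hle.trans (mul_le_mul_of_nonneg_left ?_ (norm_nonneg _))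
    have hc1 : ‖c s‖ = 1 := Complex.norm_exp_I_mul_ofReal _
    rw [norm_smul, hc1, one_mul, Lp.norm_toLp]
    exact ENNReal.toReal_mono hBs (hB s hs)
  -- The phase term `iθ‖T‖²` is imaginary, and the other two vanish in real part by norm
  -- conservation for each factor.
  · rw [hinner]
    simp only [D, T, inner_add_right, inner_smul_right, inner_tensor, inner_self_eq_norm_sq_to_K]
    simp [hx₀, hy₀, ← Complex.ofReal_pow]
  · rw [hinner]
    exact im_inner_tensor_residual hS
  · rw [smul_comm, ← smul_add, inner_smul_right, inner_smul_right, hweak]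

end Error

/-! ### Variances -/

section Variance

variable {X : Type*} [MeasureSpace X]

lemma eLpNorm_two_eq {f : X → ℂ} (hf : MemLp f 2 volume) :
    eLpNorm f 2 volume = ENNReal.ofReal (Real.sqrt (∫ x, ‖f x‖ ^ 2)) := by
  have h : ∫ x, ‖f x‖ ^ 2 = ‖hf.toLp f‖ ^ 2 := by
    rw [← integral_sq_norm]
    refine integral_congr_ae ?_
    filter_upwards [hf.coeFn_toLp] with x hx
    rw [hx]
  rw [h, Real.sqrt_sq (norm_nonneg _), Lp.norm_toLp, ENNReal.ofReal_toReal hf.2.ne]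

lemma avg_const_mul (c : ℝ) (g : X → ℝ) (φ : X → ℂ) :
    avg (fun x => c * g x) φ = c * avg g φ := by
  simp only [avg, mul_assoc, integral_const_mul, mul_div_assoc]

lemma avg_mul_const (c : ℝ) (g : X → ℝ) (φ : X → ℂ) :
    avg (fun x => g x * c) φ = avg g φ * c := by
  simp only [mul_comm _ c, avg_const_mul]

lemma avg_sub {g k : X → ℝ} {φ : X → ℂ} (hg : Integrable fun x => g x * ‖φ x‖ ^ 2)
    (hk : Integrable fun x => k x * ‖φ x‖ ^ 2) :
    avg (fun x => g x - k x) φ = avg g φ - avg k φ := by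
  simp only [avg, sub_mul]
  rw [integral_sub hg hk, sub_div]

lemma memLp_sub_const_mul {g : X → ℝ} {φ : L2 X} (hg : MemLp (fun x => (g x : ℂ) * φ x) 2 volume)
    (c : ℝ) : MemLp (fun x => ((g x - c : ℝ) : ℂ) * φ x) 2 volume := by
  convert hg.sub ((Lp.memLp φ).const_mul (c : ℂ)) using 1
  ext x
  simp only [Complex.ofReal_sub, Pi.sub_apply]
  ring

lemma integrable_mul_sq_norm {g : X → ℝ} {φ : L2 X}
    (hg : MemLp (fun x => (g x : ℂ) * φ x) 2 volume) : Integrable fun x => g x * ‖φ x‖ ^ 2 := by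
  refine (integrable_conj_mul (Lp.memLp φ) hg).re.congr (ae_of_all _ fun x => ?_)
  simp only
  rw [mul_left_comm, Complex.conj_mul', RCLike.re_eq_complex_re, ← Complex.ofReal_pow,
    ← Complex.ofReal_mul, Complex.ofReal_re]

lemma integrable_sq_mul_sq_norm {g : X → ℝ} {φ : L2 X}
    (hg : MemLp (fun x => (g x : ℂ) * φ x) 2 volume) :
    Integrable fun x => g x ^ 2 * ‖φ x‖ ^ 2 := by
  refine ((memLp_two_iff_integrable_sq_norm hg.1).1 hg).congr (ae_of_all _ fun x => ?_)
  simp only [norm_mul, Complex.norm_real, Real.norm_eq_abs, mul_pow, sq_abs]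

lemma integral_sq_norm_sub_const_mul {g : X → ℝ} {φ : L2 X}
    (hg : MemLp (fun x => (g x : ℂ) * φ x) 2 volume) (c : ℝ) :
    ∫ x, ‖((g x - c : ℝ) : ℂ) * φ x‖ ^ 2
      = (∫ x, g x ^ 2 * ‖φ x‖ ^ 2) - 2 * c * (∫ x, g x * ‖φ x‖ ^ 2) + c ^ 2 * ∫ x, ‖φ x‖ ^ 2 := by
  rw [← integral_const_mul, ← integral_const_mul, ← integral_sub (integrable_sq_mul_sq_norm hg)
    ((integrable_mul_sq_norm hg).const_mul _)]
  refine Eq.trans (integral_congr_ae (ae_of_all _ fun x => ?_)) (integral_add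
    ((integrable_sq_mul_sq_norm hg).sub ((integrable_mul_sq_norm hg).const_mul _))
    ((integrable_sq_norm φ).const_mul _))
  simp only [norm_mul, Complex.norm_real, Real.norm_eq_abs, mul_pow, sq_abs]
  ring

/-- Clearing the denominator is legitimate for `φ = 0` too, as both sides are then zero. Later
variance identities thus need no case distinction. -/
lemma integral_mul_sq_norm_eq (g : X → ℝ) (φ : L2 X) :
    ∫ x, g x * ‖φ x‖ ^ 2 = avg g φ * ‖φ‖ ^ 2 := by
  rcases eq_or_ne φ 0 with rfl | h
  · rw [norm_zero, zero_pow two_ne_zero, mul_zero]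
    refine integral_eq_zero_of_ae ?_
    filter_upwards [Lp.coeFn_zero ℂ 2 (volume : Measure X)] with x hx
    change g x * ‖(0 : L2 X) x‖ ^ 2 = 0
    rw [hx]
    simp
  · rw [avg, integral_sq_norm, div_mul_cancel₀]
    exact pow_ne_zero 2 (norm_ne_zero_iff.2 h)

lemma integral_sq_norm_sub_avg_mul {g : X → ℝ} {φ : L2 X}
    (hg : MemLp (fun x => (g x : ℂ) * φ x) 2 volume) :
    ∫ x, ‖((g x - avg g φ : ℝ) : ℂ) * φ x‖ ^ 2
      = ‖φ‖ ^ 2 * (avg (fun x => g x ^ 2) φ - avg g φ ^ 2) := by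
  rw [integral_sq_norm_sub_const_mul hg, integral_mul_sq_norm_eq g,
    integral_mul_sq_norm_eq (fun x => g x ^ 2), integral_sq_norm]
  ring

lemma eLpNorm_sub_avg_mul {g : X → ℝ} {φ : L2 X}
    (hg : MemLp (fun x => (g x : ℂ) * φ x) 2 volume) :
    eLpNorm (fun x => ((g x - avg g φ : ℝ) : ℂ) * φ x) 2 volume = eLpNorm φ 2 volume *
      ENNReal.ofReal (Real.sqrt (avg (fun x => g x ^ 2) φ - avg g φ ^ 2)) := by
  rw [eLpNorm_two_eq (memLp_sub_const_mul hg _), integral_sq_norm_sub_avg_mul hg,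
    Real.sqrt_mul (sq_nonneg _), Real.sqrt_sq (norm_nonneg _),
    ENNReal.ofReal_mul (norm_nonneg _), ofReal_norm, Lp.enorm_def]

lemma variance_nonneg {g : X → ℝ} {φ : L2 X}
    (hg : MemLp (fun x => (g x : ℂ) * φ x) 2 volume) :
    0 ≤ avg (fun x => g x ^ 2) φ - avg g φ ^ 2 := by
  rcases eq_or_ne φ 0 with rfl | h
  · have h₀ : ∫ x, ‖(0 : L2 X) x‖ ^ 2 = 0 := by
      rw [integral_sq_norm]
      simp
    simp only [avg, h₀, div_zero]
    norm_num
  · have h₁ : 0 ≤ ‖φ‖ ^ 2 * (avg (fun x => g x ^ 2) φ - avg g φ ^ 2) := by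
      rw [← integral_sq_norm_sub_avg_mul hg]
      exact integral_nonneg fun x => sq_nonneg _
    exact nonneg_of_mul_nonneg_right h₁ (by positivity)

/-- The average is the best constant approximation. -/
lemma eLpNorm_sub_avg_mul_le {g : X → ℝ} (hg : AEStronglyMeasurable g volume) (φ : L2 X) (c : ℝ) :
    eLpNorm (fun x => ((g x - avg g φ : ℝ) : ℂ) * φ x) 2 volume
      ≤ eLpNorm (fun x => ((g x - c : ℝ) : ℂ) * φ x) 2 volume := by
  by_cases hc : eLpNorm (fun x => ((g x - c : ℝ) : ℂ) * φ x) 2 volume = ⊤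
  · exact hc ▸ le_top
  have hm : MemLp (fun x => ((g x - c : ℝ) : ℂ) * φ x) 2 volume :=
    ⟨(Complex.continuous_ofReal.comp_aestronglyMeasurable
      (hg.sub aestronglyMeasurable_const)).mul (Lp.memLp φ).1, lt_top_iff_ne_top.2 hc⟩
  have hgφ : MemLp (fun x => (g x : ℂ) * φ x) 2 volume := by
    -- Finiteness for one constant `c` gives it for all: shifting back by `-c` recovers `g φ`
    -- itself.
    simpa using memLp_sub_const_mul (g := fun x => g x - c) hm (-c)
  rw [eLpNorm_two_eq hm, eLpNorm_two_eq (memLp_sub_const_mul hgφ _)]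
  refine ENNReal.ofReal_le_ofReal (Real.sqrt_le_sqrt ?_)
  rw [integral_sq_norm_sub_const_mul hgφ, integral_sq_norm_sub_const_mul hgφ,
    integral_mul_sq_norm_eq g, integral_sq_norm]
  -- The two sides differ by exactly `(c - ⟨g⟩)² ‖φ‖²`.
  nlinarith [mul_nonneg (sq_nonneg (c - avg g φ)) (sq_nonneg ‖φ‖)]

lemma lintegral_sub_avg_mul_le {g : X → ℝ} (hg : AEStronglyMeasurable g volume) (φ : L2 X) (c : ℝ) :
    ∫⁻ x, ‖((g x - avg g φ : ℝ) : ℂ) * φ x‖ₑ ^ 2 ≤ ∫⁻ x, ‖((g x - c : ℝ) : ℂ) * φ x‖ₑ ^ 2 := by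
  rw [← sq_eLpNorm_two, ← sq_eLpNorm_two]
  gcongr
  exact eLpNorm_sub_avg_mul_le hg φ c

end Variance

/-! ### Bounds on the residual -/

section Product

variable {n d : ℕ} {W₁ : Euc n → ℝ} {W₂ : Euc d → ℝ}

lemma residual_product (φ : L2 (Euc n)) (χ : L2 (Euc d)) :
    residual (fun x y => W₁ x * W₂ y) (avg W₁ φ * avg W₂ χ) φ χ
      = fun z => (((W₁ z.1 - avg W₁ φ : ℝ) : ℂ) * φ z.1) * (((W₂ z.2 - avg W₂ χ : ℝ) : ℂ) * χ z.2) := by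
  ext z
  simp only [residual, avg_const_mul, avg_mul_const]
  push_cast
  ring

lemma eLpNorm_residual_product (hW₁ : Continuous W₁) (hW₂ : Continuous W₂) (φ : L2 (Euc n))
    (χ : L2 (Euc d)) :
    eLpNorm (residual (fun x y => W₁ x * W₂ y) (avg W₁ φ * avg W₂ χ) φ χ) 2 volume
      = eLpNorm (fun x => ((W₁ x - avg W₁ φ : ℝ) : ℂ) * φ x) 2 volume
        * eLpNorm (fun y => ((W₂ y - avg W₂ χ : ℝ) : ℂ) * χ y) 2 volume := by
  rw [residual_product]
  refine eLpNorm_tensor (f := fun x => ((W₁ x - avg W₁ φ : ℝ) : ℂ) * φ x)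
    (g := fun y => ((W₂ y - avg W₂ χ : ℝ) : ℂ) * χ y) ?_ ?_
  · exact (Complex.continuous_ofReal.comp (hW₁.sub continuous_const)).aestronglyMeasurable.mul
      (Lp.memLp φ).1
  · exact (Complex.continuous_ofReal.comp (hW₂.sub continuous_const)).aestronglyMeasurable.mul
      (Lp.memLp χ).1

lemma Setting.fullAvg_product {V₁ : Euc n → ℝ} {V₂ : Euc d → ℝ} {φ₀x : Euc n → ℂ} {φ₀y : Euc d → ℂ}
    {ψ : ℝ → L2 (Euc n × Euc d)} {φx : ℝ → L2 (Euc n)} {φy : ℝ → L2 (Euc d)}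
    (h : Setting V₁ V₂ (fun x y => W₁ x * W₂ y) φ₀x φ₀y ψ φx φy) {t : ℝ} (ht : 0 ≤ t) :
    fullAvg (fun x y => W₁ x * W₂ y) φx φy t = avg W₁ (φx t) * avg W₂ (φy t) := by
  rw [h.fullAvg_eq ht]
  simp only [avg_const_mul, avg_mul_const]

end Product

/-! ### From the weighted gradient bound to the oscillation of `W` in `y` -/

section Gradient

variable {n d : ℕ} {W : Euc n → Euc d → ℝ}

lemma hasFDerivAt_slice_snd (hW : ContDiff ℝ ∞ fun z : Euc n × Euc d => W z.1 z.2) (x : Euc n)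
    (y : Euc d) : HasFDerivAt (fun y => W x y)
      ((fderiv ℝ (fun z : Euc n × Euc d => W z.1 z.2) (x, y)).comp
        (ContinuousLinearMap.inr ℝ (Euc n) (Euc d))) y :=
  ((hW.differentiable (by simp)).differentiableAt.hasFDerivAt (x := (x, y))).comp y
    (hasFDerivAt_prodMk_right x y)

lemma continuous_bracket_rpow {m : ℕ} (σ : ℝ) : Continuous fun x : Euc m => bracket x ^ σ :=
  continuous_bracket.rpow_const fun x => Or.inl (zero_lt_one.trans_le (one_le_bracket x)).ne'

lemma norm_gradient {f : Euc d → ℝ} (y : Euc d) : ‖gradient f y‖ = ‖fderiv ℝ f y‖ :=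
  LinearIsometryEquiv.norm_map _ _

/-- The set where the bound fails is open and null, hence empty. The mean value inequality needs the
essential bound on the gradient at every point. -/
lemma le_of_ae_le_of_continuous {X : Type*} [TopologicalSpace X] [MeasureSpace X]
    [(volume : Measure X).IsOpenPosMeasure] {f : X → ℝ} (hf : Continuous f) {c : ℝ}
    (h : ∀ᵐ x, f x ≤ c) (x : X) : f x ≤ c := by
  by_contra! hx
  have h₀ : volume {x | c < f x} = 0 := by
    simpa only [ae_iff, not_le] using h
  have h₁ := ((isOpen_lt continuous_const hf).measure_eq_zero_iff (μ := volume)).1 h₀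
  exact (h₁ ▸ (show x ∈ {x | c < f x} from hx) : x ∈ (∅ : Set X)).elim

lemma norm_fderiv_slice_le (hW : ContDiff ℝ ∞ fun z : Euc n × Euc d => W z.1 z.2) {σx σy : ℝ}
    {η : ℝ≥0∞} (hη : η = eLpNorm (fun z : Euc n × Euc d => bracket z.1 ^ (-σx) *
      bracket z.2 ^ (-σy) * ‖gradient (fun y => W z.1 y) z.2‖) ⊤ volume) (hη' : η ≠ ⊤)
    (x : Euc n) (y : Euc d) :
    ‖fderiv ℝ (fun y => W x y) y‖ ≤ η.toReal * bracket x ^ σx * bracket y ^ σy := by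
  have hfd (z : Euc n × Euc d) : fderiv ℝ (fun y => W z.1 y) z.2
      = (fderiv ℝ (fun z : Euc n × Euc d => W z.1 z.2) z).comp
        (ContinuousLinearMap.inr ℝ (Euc n) (Euc d)) :=
    (hasFDerivAt_slice_snd hW z.1 z.2).fderiv
  have hc : Continuous fun z : Euc n × Euc d => bracket z.1 ^ (-σx) *
      bracket z.2 ^ (-σy) * ‖gradient (fun y => W z.1 y) z.2‖ := by
    simp only [norm_gradient, hfd]
    exact (((continuous_bracket_rpow (-σx)).comp continuous_fst).mul
      ((continuous_bracket_rpow (-σy)).comp continuous_snd)).mul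
        ((hW.continuous_fderiv (by simp)).clm_comp continuous_const).norm
  have hb (m : ℕ) (x : Euc m) : 0 < bracket x := zero_lt_one.trans_le (one_le_bracket x)
  have hle := le_of_ae_le_of_continuous hc (c := η.toReal) (by
    rw [eLpNorm_exponent_top] at hη
    filter_upwards [ae_le_eLpNormEssSup (μ := volume) (f := fun z : Euc n × Euc d =>
      bracket z.1 ^ (-σx) * bracket z.2 ^ (-σy) * ‖gradient (fun y => W z.1 y) z.2‖)] with z hz
    rw [← hη] at hz
    have := ENNReal.toReal_mono hη' hz
    rw [toReal_enorm] at this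
    exact (Real.le_norm_self _).trans this) (x, y)
  rw [norm_gradient, Real.rpow_neg (hb _ _).le, Real.rpow_neg (hb _ _).le] at hle
  have h₁ := Real.rpow_pos_of_pos (hb _ x) σx
  have h₂ := Real.rpow_pos_of_pos (hb _ y) σy
  rw [← mul_inv, inv_mul_le_iff₀ (by positivity)] at hle
  exact hle.trans_eq (by ring)

lemma abs_sub_le_of_gradient (hW : ContDiff ℝ ∞ fun z : Euc n × Euc d => W z.1 z.2) {σx σy : ℝ}
    (hσy : 0 ≤ σy) {η : ℝ≥0∞} (hη : η = eLpNorm (fun z : Euc n × Euc d => bracket z.1 ^ (-σx) *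
      bracket z.2 ^ (-σy) * ‖gradient (fun y => W z.1 y) z.2‖) ⊤ volume) (hη' : η ≠ ⊤)
    (x : Euc n) (y : Euc d) :
    |W x y - W x 0| ≤ η.toReal * bracket x ^ σx * (bracket y ^ σy * ‖y‖) := by
  have hb (m : ℕ) (x : Euc m) : 0 < bracket x := zero_lt_one.trans_le (one_le_bracket x)
  have h := (convex_closedBall (0 : Euc d) ‖y‖).norm_image_sub_le_of_norm_fderiv_le (𝕜 := ℝ)
    (f := fun y => W x y) (C := η.toReal * bracket x ^ σx * bracket y ^ σy)
    (fun w _ => (hasFDerivAt_slice_snd hW x w).differentiableAt) (fun w hw => ?_)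
    (Metric.mem_closedBall_self (norm_nonneg y)) (mem_closedBall_zero_iff.2 le_rfl)
  · rw [sub_zero, mul_assoc] at h
    exact h
  · refine (norm_fderiv_slice_le hW hη hη' x w).trans ?_
    -- On the ball of radius `‖y‖` the weight is largest at the boundary, because `σy ≥ 0`.
    have hwy : bracket w ≤ bracket y := by
      rw [mem_closedBall_zero_iff] at hw
      unfold bracket
      gcongr
    have := Real.rpow_pos_of_pos (hb _ x) σx
    gcongr
    exact (hb _ w).le

end Gradient

/-! ### The residual for couplings that are not products -/

section General

variable {n d : ℕ} {V₁ : Euc n → ℝ} {V₂ : Euc d → ℝ} {W : Euc n → Euc d → ℝ}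
  {φ₀x : Euc n → ℂ} {φ₀y : Euc d → ℂ} {ψ : ℝ → L2 (Euc n × Euc d)}
  {φx : ℝ → L2 (Euc n)} {φy : ℝ → L2 (Euc d)}

/-- Removing the averages one variable at a time does not increase the residual. -/
lemma Setting.lintegral_residual_le (h : Setting V₁ V₂ W φ₀x φ₀y ψ φx φy) {t : ℝ} (ht : 0 ≤ t)
    (k : Euc n → ℝ) :
    ∫⁻ z, ‖residual W (fullAvg W φx φy t) (φx t) (φy t) z‖ₑ ^ 2
      ≤ ∫⁻ x, ‖φx t x‖ₑ ^ 2 * ∫⁻ y, ‖((W x y - k x : ℝ) : ℂ) * φy t y‖ₑ ^ 2 := by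
  obtain ⟨C, hC₀, hC⟩ := h.exists_bound
  have hW := h.continuous
  set φ := φx t
  set χ := φy t
  let A : Euc n → ℝ := fun x => avg (fun y => W x y) χ
  have hA : Continuous A := h.continuous_avg_y ht
  have hφ : Integrable fun x => bracket x ^ 2 * ‖φ x‖ ^ 2 := h.integrable_x ht
  have hχ : Integrable fun y => bracket y ^ 2 * ‖χ y‖ ^ 2 := h.integrable_y ht
  have hAφ : Integrable fun x => A x * ‖φ x‖ ^ 2 := by
    have hi := integrable_coupling hW hC hφ hχ
    rw [Measure.volume_eq_prod] at hi
    refine (hi.integral_prod_left.div_const (∫ y, ‖χ y‖ ^ 2)).congr (ae_of_all _ fun x => ?_)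
    simp only [A, avg, mul_left_comm _ (‖φ x‖ ^ 2), integral_const_mul]
    ring
  have hWφ (y : Euc d) : Integrable fun x => W x y * ‖φ x‖ ^ 2 :=
    integrable_coupling_snd (W := fun y x => W x y) (hW.comp continuous_swap)
      (fun y x => by rw [mul_right_comm]; exact hC x y) hφ y
  -- Hence the residual is `W - A` minus its own average in `x`, where `A` is the average in `y`.
  have havg (y : Euc d) : avg (fun x => W x y - A x) φ
      = avg (fun x => W x y) φ - fullAvg W φx φy t := by
    rw [avg_sub (hWφ y) hAφ, h.fullAvg_eq ht]
  have hr (x : Euc n) (y : Euc d) : residual W (fullAvg W φx φy t) φ χ (x, y)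
      = ((W x y - A x - avg (fun x => W x y - A x) φ : ℝ) : ℂ) * φ x * χ y := by
    rw [havg, residual, mul_assoc]
    congr 2
    simp only [A]
    ring
  have hm₁ := (h.aestronglyMeasurable_residual ht (fullAvg W φx φy t)).enorm.pow_const 2
  have hc : Continuous fun z : Euc n × Euc d => ((W z.1 z.2 - A z.1 : ℝ) : ℂ) :=
    Complex.continuous_ofReal.comp (hW.sub (hA.comp continuous_fst))
  have hm₂ : AEMeasurable (fun z : Euc n × Euc d =>
      ‖((W z.1 z.2 - A z.1 : ℝ) : ℂ) * (φ z.1 * χ z.2)‖ₑ ^ 2) volume :=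
    (hc.aestronglyMeasurable.mul (aestronglyMeasurable_tensor (Lp.memLp φ).1
      (Lp.memLp χ).1)).enorm.pow_const 2
  rw [Measure.volume_eq_prod] at hm₁ hm₂ ⊢
  calc ∫⁻ z, ‖residual W (fullAvg W φx φy t) φ χ z‖ₑ ^ 2 ∂(volume.prod volume)
      = ∫⁻ y, ∫⁻ x, ‖residual W (fullAvg W φx φy t) φ χ (x, y)‖ₑ ^ 2 := lintegral_prod_symm _ hm₁
    _ ≤ ∫⁻ y, ∫⁻ x, ‖((W x y - A x : ℝ) : ℂ) * (φ x * χ y)‖ₑ ^ 2 := by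
        refine lintegral_mono fun y => ?_
        simp only [hr, ← mul_assoc]
        simp only [enorm_mul _ (χ y), mul_pow _ ‖χ y‖ₑ]
        rw [lintegral_mul_const' _ _ (by finiteness), lintegral_mul_const' _ _ (by finiteness)]
        refine mul_le_mul' ?_ le_rfl
        have hcy : Continuous fun x => W x y - A x := (hW.comp (Continuous.prodMk_left y)).sub hA
        -- For fixed `y`, the average in `x` is replaced by the constant 0.
        simpa only [sub_zero] using lintegral_sub_avg_mul_le hcy.aestronglyMeasurable φ 0
    _ = ∫⁻ x, ∫⁻ y, ‖((W x y - A x : ℝ) : ℂ) * (φ x * χ y)‖ₑ ^ 2 := by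
        rw [← lintegral_prod_symm _ hm₂, lintegral_prod _ hm₂]
    _ ≤ ∫⁻ x, ‖φ x‖ₑ ^ 2 * ∫⁻ y, ‖((W x y - k x : ℝ) : ℂ) * χ y‖ₑ ^ 2 := by
        refine lintegral_mono fun x => ?_
        simp only [mul_left_comm _ (φ x)]
        simp only [enorm_mul (φ x), mul_pow ‖φ x‖ₑ]
        rw [lintegral_const_mul' _ _ (by finiteness)]
        refine mul_le_mul' le_rfl ?_
        have hcx : Continuous fun y => W x y := hW.comp (Continuous.prodMk_right x)
        -- After the order of integration is exchanged, `x` is fixed, so the average `A x` in `y`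
        -- may be replaced by any `k x`.
        exact lintegral_sub_avg_mul_le hcx.aestronglyMeasurable χ (k x)

lemma Setting.eLpNorm_residual_le (h : Setting V₁ V₂ W φ₀x φ₀y ψ φx φy) {t : ℝ} (ht : 0 ≤ t)
    {σx σy : ℝ} (hσy : 0 ≤ σy) {η : ℝ≥0∞}
    (hη : η = eLpNorm (fun z : Euc n × Euc d => bracket z.1 ^ (-σx) *
      bracket z.2 ^ (-σy) * ‖gradient (fun y => W z.1 y) z.2‖) ⊤ volume) (hη' : η ≠ ⊤) :
    eLpNorm (residual W (fullAvg W φx φy t) (φx t) (φy t)) 2 volume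
      ≤ η * (eLpNorm (fun x => ((bracket x ^ σx : ℝ) : ℂ) * φx t x) 2 volume *
        eLpNorm (fun y => ((bracket y ^ σy * ‖y‖ : ℝ) : ℂ) * φy t y) 2 volume) := by
  refine eLpNorm_two_le_of_sq ((h.lintegral_residual_le ht fun x => W x 0).trans ?_)
  have hbound (x : Euc n) (y : Euc d) : ‖((W x y - W x 0 : ℝ) : ℂ)‖ₑ
      ≤ η * ‖((bracket x ^ σx : ℝ) : ℂ)‖ₑ * ‖((bracket y ^ σy * ‖y‖ : ℝ) : ℂ)‖ₑ := by
    have hx : 0 ≤ bracket x ^ σx := Real.rpow_nonneg (Real.sqrt_nonneg _) _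
    have hy : 0 ≤ bracket y ^ σy * ‖y‖ :=
      mul_nonneg (Real.rpow_nonneg (Real.sqrt_nonneg _) _) (norm_nonneg _)
    rw [← ofReal_norm, ← ofReal_norm, ← ofReal_norm, Complex.norm_real, Complex.norm_real,
      Complex.norm_real, Real.norm_of_nonneg hx, Real.norm_of_nonneg hy, Real.norm_eq_abs,
      ← ENNReal.ofReal_toReal hη', ← ENNReal.ofReal_mul ENNReal.toReal_nonneg,
      ← ENNReal.ofReal_mul (by positivity)]
    exact ENNReal.ofReal_le_ofReal (abs_sub_le_of_gradient h.smooth hσy hη hη' x y)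
  have hm : AEMeasurable (fun x => ‖((bracket x ^ σx : ℝ) : ℂ) * φx t x‖ₑ ^ 2) volume :=
    ((Complex.continuous_ofReal.comp (continuous_bracket_rpow σx)).aestronglyMeasurable.mul
      (Lp.memLp (φx t)).1).enorm.pow_const 2
  calc ∫⁻ x, ‖φx t x‖ₑ ^ 2 * ∫⁻ y, ‖((W x y - W x 0 : ℝ) : ℂ) * φy t y‖ₑ ^ 2
      ≤ ∫⁻ x, ‖φx t x‖ₑ ^ 2 * ∫⁻ y, (η * ‖((bracket x ^ σx : ℝ) : ℂ)‖ₑ) ^ 2 *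
          ‖((bracket y ^ σy * ‖y‖ : ℝ) : ℂ) * φy t y‖ₑ ^ 2 := by
        refine lintegral_mono fun x => mul_le_mul' le_rfl (lintegral_mono fun y => ?_)
        rw [enorm_mul, enorm_mul, ← mul_pow, ← mul_assoc]
        gcongr
        exact hbound x y
    _ = ∫⁻ x, η ^ 2 * ‖((bracket x ^ σx : ℝ) : ℂ) * φx t x‖ₑ ^ 2 *
          ∫⁻ y, ‖((bracket y ^ σy * ‖y‖ : ℝ) : ℂ) * φy t y‖ₑ ^ 2 := by
        refine lintegral_congr fun x => ?_
        rw [lintegral_const_mul' _ _ (by finiteness), enorm_mul _ (φx t x)]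
        ring
    _ = (η * (eLpNorm (fun x => ((bracket x ^ σx : ℝ) : ℂ) * φx t x) 2 volume *
        eLpNorm (fun y => ((bracket y ^ σy * ‖y‖ : ℝ) : ℂ) * φy t y) 2 volume)) ^ 2 := by
        rw [lintegral_mul_const'' _ (hm.const_mul _), lintegral_const_mul' _ _ (by finiteness),
          mul_pow, mul_pow, sq_eLpNorm_two, sq_eLpNorm_two, mul_assoc]

end General

end Hartree

end

/-! ### The three error estimates -/

theorem mainTheorem2 (n d : ℕ) (V₁ : Hartree.Euc n → ℝ) (V₂ : Hartree.Euc d → ℝ)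
    (hV₁ : ContDiff ℝ ∞ V₁) (hV₂ : ContDiff ℝ ∞ V₂)
    (φ₀x : 𝓢(Hartree.Euc n, ℂ)) (φ₀y : 𝓢(Hartree.Euc d, ℂ))
    (ψ : ℝ → Hartree.L2 (Hartree.Euc n × Hartree.Euc d))
    (φx : ℝ → Hartree.L2 (Hartree.Euc n)) (φy : ℝ → Hartree.L2 (Hartree.Euc d)) :
    -- gradient-free estimate for product couplings
    (∀ (W₁ : Hartree.Euc n → ℝ) (W₂ : Hartree.Euc d → ℝ),
      ContDiff ℝ ∞ W₁ → ContDiff ℝ ∞ W₂ →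
      Hartree.Setting V₁ V₂ (fun x y => W₁ x * W₂ y) φ₀x φ₀y ψ φx φy →
      (∀ s, 0 ≤ s → MemLp (fun x => (W₁ x : ℂ) * φx s x) 2 volume) →
      (∀ s, 0 ≤ s → MemLp (fun y => (W₂ y : ℂ) * φy s y) 2 volume) →
      ∀ t, 0 ≤ t →
        Hartree.meanFieldError (fun x y => W₁ x * W₂ y) ψ φx φy t ≤
          eLpNorm φ₀x 2 volume * eLpNorm φ₀y 2 volume *
            ∫⁻ s in Icc (0 : ℝ) t, ENNReal.ofReal (Real.sqrt
              ((Hartree.avg (fun x => W₁ x ^ 2) (φx s) - Hartree.avg W₁ (φx s) ^ 2) *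
                (Hartree.avg (fun y => W₂ y ^ 2) (φy s) - Hartree.avg W₂ (φy s) ^ 2)))) ∧
    -- bounded `W₁` and `W₂(y) = η |y|²`
    (∀ (W₁ : Hartree.Euc n → ℝ) (η : ℝ), ContDiff ℝ ∞ W₁ → MemLp W₁ ⊤ volume → 0 ≤ η →
      Hartree.Setting V₁ V₂ (fun x y => W₁ x * (η * ‖y‖ ^ 2)) φ₀x φ₀y ψ φx φy →
      ∀ t, 0 ≤ t →
        Hartree.meanFieldError (fun x y => W₁ x * (η * ‖y‖ ^ 2)) ψ φx φy t ≤
          16 * ENNReal.ofReal η * eLpNorm W₁ ⊤ volume * eLpNorm φ₀x 2 volume *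
            ∫⁻ s in Icc (0 : ℝ) t, eLpNorm (fun y => ((‖y‖ ^ 2 : ℝ) : ℂ) * φy s y) 2 volume) ∧
    -- weighted estimate for general couplings
    (∀ (W : Hartree.Euc n → Hartree.Euc d → ℝ) (σx σy : ℝ) (η : ℝ≥0∞), 0 ≤ σx → 0 ≤ σy →
      η = eLpNorm (fun z : Hartree.Euc n × Hartree.Euc d =>
        Hartree.bracket z.1 ^ (-σx) * Hartree.bracket z.2 ^ (-σy) *
          ‖gradient (fun y => W z.1 y) z.2‖) ⊤ volume → η ≠ ⊤ →
      Hartree.Setting V₁ V₂ W φ₀x φ₀y ψ φx φy →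
      ∀ t, 0 ≤ t →
        Hartree.meanFieldError W ψ φx φy t ≤
          8 * η * ∫⁻ s in Icc (0 : ℝ) t,
            eLpNorm (fun x => ((Hartree.bracket x ^ σx : ℝ) : ℂ) * φx s x) 2 volume *
              eLpNorm (fun y => ((Hartree.bracket y ^ σy * ‖y‖ : ℝ) : ℂ) * φy s y) 2 volume) := by
  refine ⟨fun W₁ W₂ hW₁ hW₂ h hm₁ hm₂ t ht => ?_, fun W₁ η hW₁ hb hη h t ht => ?_,
    fun W σx σy η _ hσy hη hη' h t ht => ?_⟩
  · have hx := fun s (hs : 0 ≤ s) => h.eLpNorm_x hV₁.continuous hs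
    have hy := fun s (hs : 0 ≤ s) => h.eLpNorm_y hV₂.continuous hs
    -- A finite constant moves under the integral without measurability of the integrand.
    have hfin : eLpNorm φ₀x 2 volume * eLpNorm φ₀y 2 volume ≠ ⊤ := by
      rw [← hx 0 le_rfl, ← hy 0 le_rfl]
      exact ENNReal.mul_ne_top (Lp.eLpNorm_ne_top _) (Lp.eLpNorm_ne_top _)
    rw [← lintegral_const_mul' _ _ hfin]
    refine h.meanFieldError_le hV₁.continuous hV₂.continuous (fun s hs => le_of_eq ?_) ht
    rw [h.fullAvg_product hs, Hartree.eLpNorm_residual_product hW₁.continuous hW₂.continuous,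
      Hartree.eLpNorm_sub_avg_mul (hm₁ s hs), Hartree.eLpNorm_sub_avg_mul (hm₂ s hs), hx s hs,
      hy s hs, Real.sqrt_mul (Hartree.variance_nonneg (hm₁ s hs)),
      ENNReal.ofReal_mul (Real.sqrt_nonneg _), mul_mul_mul_comm]
  · have hx := fun s (hs : 0 ≤ s) => h.eLpNorm_x hV₁.continuous hs
    have hfin : 16 * ENNReal.ofReal η * eLpNorm W₁ ⊤ volume * eLpNorm φ₀x 2 volume ≠ ⊤ := by
      rw [← hx 0 le_rfl]
      exact ENNReal.mul_ne_top (ENNReal.mul_ne_top (ENNReal.mul_ne_top (by norm_num)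
        ENNReal.ofReal_ne_top) hb.2.ne) (Lp.eLpNorm_ne_top _)
    have hW₂ : Continuous fun y : Hartree.Euc d => η * ‖y‖ ^ 2 := by fun_prop
    rw [← lintegral_const_mul' _ _ hfin]
    refine h.meanFieldError_le hV₁.continuous hV₂.continuous (fun s hs => ?_) ht
    rw [Hartree.Setting.fullAvg_product h hs,
      Hartree.eLpNorm_residual_product hW₁.continuous hW₂]
    -- Both standard deviations are bounded by the uncentred second moments.
    have h₁ := Hartree.eLpNorm_sub_avg_mul_le hW₁.continuous.aestronglyMeasurable (φx s) 0
    have h₂ := Hartree.eLpNorm_sub_avg_mul_le hW₂.aestronglyMeasurable (φy s) 0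
    simp only [sub_zero] at h₁ h₂
    have h₃ : eLpNorm (fun x => (W₁ x : ℂ) * φx s x) 2 volume
        ≤ eLpNorm W₁ ⊤ volume * eLpNorm φ₀x 2 volume := by
      have := eLpNorm_smul_le_eLpNorm_top_mul_eLpNorm 2 (Lp.memLp (φx s)).1 W₁
      rw [hx s hs] at this
      refine le_trans (le_of_eq ?_) this
      simp only [Pi.smul_def', Complex.real_smul]
    have h₄ : eLpNorm (fun y => ((η * ‖y‖ ^ 2 : ℝ) : ℂ) * φy s y) 2 volume
        = ENNReal.ofReal η * eLpNorm (fun y => ((‖y‖ ^ 2 : ℝ) : ℂ) * φy s y) 2 volume := by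
      rw [← Real.enorm_of_nonneg hη, ← eLpNorm_const_smul]
      congr 1
      ext y
      simp only [Pi.smul_apply, Complex.real_smul, Complex.ofReal_mul, mul_assoc]
    calc _ ≤ eLpNorm W₁ ⊤ volume * eLpNorm φ₀x 2 volume * (ENNReal.ofReal η *
          eLpNorm (fun y => ((‖y‖ ^ 2 : ℝ) : ℂ) * φy s y) 2 volume) :=
          mul_le_mul' (h₁.trans h₃) (h₂.trans_eq h₄)
      _ = 1 * ENNReal.ofReal η * eLpNorm W₁ ⊤ volume * eLpNorm φ₀x 2 volume *
          eLpNorm (fun y => ((‖y‖ ^ 2 : ℝ) : ℂ) * φy s y) 2 volume := by ring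
      _ ≤ _ := by
        gcongr
        norm_num
  · rw [← lintegral_const_mul' _ _ (ENNReal.mul_ne_top (by norm_num) hη')]
    refine h.meanFieldError_le hV₁.continuous hV₂.continuous (fun s hs => ?_) ht
    refine (h.eLpNorm_residual_le hs hσy hη hη').trans ?_
    gcongr
    -- The residual bound has constant 1, relaxed here to 8.
    exact le_mul_of_one_le_left zero_le (by norm_num)
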